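/- Fix $\tau\in\mathbb C$ with $\operatorname{Im}\tau>0$, and let $\gamma$ be the meromorphic function on $\mathbb C$ $$\gamma(z)=\frac{\prod_{n\ge 1}\bigl(1-e^{-2\pi i(z-n\tau)}\bigr)}{\prod_{n\ge 0}\bigl(1-e^{-2\pi i(z+n)/\tau}\bigr)}$$ (removable singularities removed). Let $\mathrm{SE}=\{x-y\tau: x,y>0\}$ be the open southeastern sector and let $S=\{-x-y\tau: x,y\ge 0\}$ be the closed southwestern quarter, which contains all poles of $\gamma$. A *line from NW to SE* is a continuous curve $c:\mathbb R\to\mathbb C\setminus S$ that is continuously differentiable with bounded derivative outside a finite set of parameters, and whose ends are straight: for some $T\in\mathbb R$, $a,b\in\mathbb C$ and $d_1,d_2\in\mathrm{SE}$ one has $c(t)=a+td_1$ for $t\le -T$ and $c(t)=b+td_2$ for $t\ge T$. Such a line is called suitable for $z\in\mathbb C$ if $\operatorname{Im}(d_1z/\tau)<0$ and either $\operatorname{Im}(d_2^2/\tau)>0$, or $\operatorname{Im}(d_2^2/\tau)=0$ and $\operatorname{Im}\bigl(d_2(2b+2z-1-\tau)/\tau\bigr)>0$. 1. The constant $\gamma(1)$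 is given by the residue at the origin: $\gamma(1)=\frac{2\pi i}{\tau}\lim_{z\to0}z\,\gamma(z)=\frac{2\pi i}{\tau}\operatorname{Res}_{z=0}\gamma$. 2. For every $z\notin S$ there is a suitable line. 3. (Tau-gamma integral.) For every $z\in\mathbb C$ and every line $c$ from NW to SE that is suitable for $z$, the following integral along $c$ converges absolutely and $$\gamma(z)=\gamma(1)\int_{c} d\zeta\;\frac{e^{2\pi i\zeta z/\tau}}{\gamma(1+\tau-\zeta)}.$$ -/

import Mathlib

open Complex Filter Topology MeasureTheory

noncomputable section

/-- The infinite product `(a;b)_∞ = (1 - a)(1 - ab)(1 - ab²)⋯`. -/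
def qPochhammerInf (a b : ℂ) : ℂ :=
  ∏' n : ℕ, (1 - a * b ^ n)

/-- The quotient `(q² e^{-2πiz}; q²)_∞ / (e^{-2πiz/τ}; q^{-2/τ²})_∞`, with `q² = e^{2πiτ}` and
`q^{-2/τ²} = e^{-2πi/τ}`, evaluated pointwise. It takes the value `0` at the zeros of the
denominator, also at those where the singularity is removable. -/
def tauGammaQuotient (τ z : ℂ) : ℂ :=
  qPochhammerInf (exp (2 * Real.pi * I * τ) * exp (-2 * Real.pi * I * z))
      (exp (2 * Real.pi * I * τ)) /
    qPochhammerInf (exp (-2 * Real.pi * I * z / τ)) (exp (-2 * Real.pi * I / τ))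

/-- The `γ`-function: the meromorphic function on `ℂ` given by the quotient of products. The normal
form fills in the removable singularities by continuity (and has the value `0` at the poles, so
that the pointwise inverse `1 / γ` has its true value `0` there). -/
def tauGamma (τ : ℂ) : ℂ → ℂ :=
  toMeromorphicNFOn (tauGammaQuotient τ) Set.univ

/-- The open southeastern sector, spanned by `1` and `-τ`. For `0 < Im τ` this is
`arg (-τ) < arg z < 0`. Its negative is the northwestern sector. -/
def southeast (τ : ℂ) : Set ℂ :=
  {z | ∃ x y : ℝ, 0 < x ∧ 0 < y ∧ z = x - y * τ}

/-- The closed southwestern quarter, spanned by `-1` and `-τ`. It contains the points `k + l τ`,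
`k, l ≤ 0`. -/
def southwestClosed (τ : ℂ) : Set ℂ :=
  {z | ∃ x y : ℝ, 0 ≤ x ∧ 0 ≤ y ∧ z = -x - y * τ}

/-- An integration line from northwest to southeast: a continuous, piecewise continuously
differentiable curve `ℝ → ℂ` whose two ends are straight rays, which comes from infinity in the
northwestern sector, goes to infinity in the southeastern one, and passes to the northeast of the
southwestern quarter (that is, avoids it). -/
structure NWSELine (τ : ℂ) where
  /-- the parametrization -/
  toFun : ℝ → ℂ
  continuous_toFun : Continuous toFun
  /-- the corners -/
  corners : Finset ℝ
  differentiableAt_toFun : ∀ t ∉ corners, DifferentiableAt ℝ toFun t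
  continuousOn_deriv : ContinuousOn (deriv toFun) {t | t ∉ corners}
  bounded_deriv : ∃ K : ℝ, ∀ t ∉ corners, ‖deriv toFun t‖ ≤ K
  /-- outside `[-T, T]` the curve is straight -/
  T : ℝ
  /-- base point of the northwestern ray -/
  baseNW : ℂ
  /-- direction in which the northwestern ray is traversed -/
  dirNW : ℂ
  /-- base point of the southeastern ray -/
  baseSE : ℂ
  /-- direction of the southeastern ray -/
  dirSE : ℂ
  dirNW_mem : dirNW ∈ southeast τ
  dirSE_mem : dirSE ∈ southeast τ
  eq_NW : ∀ t : ℝ, t ≤ -T → toFun t = baseNW + t * dirNW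
  eq_SE : ∀ t : ℝ, T ≤ t → toFun t = baseSE + t * dirSE
  avoids : ∀ t : ℝ, toFun t ∉ southwestClosed τ

/-- The integrand of `∫ dζ f(ζ)` along the line, pulled back to the parameter. -/
def NWSELine.pullback {τ : ℂ} (c : NWSELine τ) (f : ℂ → ℂ) (t : ℝ) : ℂ :=
  deriv c.toFun t * f (c.toFun t)

/-- The integral `∫ dζ f(ζ)` along the line, from northwest to southeast. -/
def NWSELine.integral {τ : ℂ} (c : NWSELine τ) (f : ℂ → ℂ) : ℂ :=
  ∫ t : ℝ, c.pullback f t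

/-- The directions of the two ends suit the point `z`: at the northwestern end `e^{2πiζz/τ}` decays,
and at the southeastern end the product `e^{iπζ(ζ-1-τ)/τ} e^{2πiζz/τ}` of a Gaussian and this
exponential decays, either through its quadratic part or, where the quadratic part only
oscillates, through its linear part. -/
def NWSELine.Suits {τ : ℂ} (c : NWSELine τ) (z : ℂ) : Prop :=
  (c.dirNW * z / τ).im < 0 ∧
    (0 < (c.dirSE ^ 2 / τ).im ∨
      ((c.dirSE ^ 2 / τ).im = 0 ∧ 0 < (c.dirSE * (2 * c.baseSE + 2 * z - 1 - τ) / τ).im))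

/-- The function `ζ ↦ e^{2πiζz/τ} / γ(1 + τ - ζ)`. -/
def tauGammaIntegrand (τ z ζ : ℂ) : ℂ :=
  exp (2 * Real.pi * I * ζ * z / τ) / tauGamma τ (1 + τ - ζ)

end

noncomputable section

/-! ### The infinite product -/

/-! Write γ = N/D with N = `gammaNum`, D = `gammaDen`, and let I(z) be the integral along any
suitable line. Both γ and I satisfy f(z+1) = (1 - e^{-2πiz/τ}) f(z) and f(z+τ) = (1 - e^{-2πiz})
f(z). Their ratio is therefore doubly periodic; it extends to an entire function, so Liouville makes
it constant, and I(1) = 1 fixes the constant (`tauGammaIntegral_mul_eq`, `tauGammaIntegral_one`).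

The analytic input is the theta inversion `exists_thetaNum_eq`: N(z)N(1+τ-z) and D(z)D(1+τ-z) agree
up to a constant and a Gaussian. The complement of S is the union of the half-planes Im(z/τ) < 0 and
Im z > 0. The inversion gives γ and 1/γ(1+τ-ζ) an explicit form with nonvanishing denominator on
each of them, so both are holomorphic off S. It also shows that 1/γ(1+τ-ζ) tends to 1 in the
northwest and is bounded by a Gaussian in the southeast, whence the integral converges.

Off S the integrand has a primitive, and its limits at the two ends do not depend on the suitable
line (`NWSELine.integral_eq_of_suits`). Hence translating the line by 1 or τ does not change the
integral, and the difference equations of 1/γ turn into those of I. For I(1), the integrand at z = 1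
is a difference f(ζ) - f(ζ+1), with f the integrand at z = 0, so the integral telescopes to boundary
terms. -/

lemma summable_norm_mul_pow (a : ℂ) {b : ℂ} (hb : ‖b‖ < 1) :
    Summable fun n : ℕ => ‖-(a * b ^ n)‖ := by
  simpa [norm_mul, norm_pow] using
    (summable_geometric_of_lt_one (norm_nonneg b) hb).mul_left ‖a‖

lemma qPochhammerInf_eq (a b : ℂ) :
    qPochhammerInf a b = ∏' n : ℕ, (1 + -(a * b ^ n)) := by
  simp [qPochhammerInf, sub_eq_add_neg]

lemma multipliable_one_sub_mul_pow (a : ℂ) {b : ℂ} (hb : ‖b‖ < 1) :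
    Multipliable fun n : ℕ => 1 - a * b ^ n := by
  simpa [sub_eq_add_neg] using multipliable_one_add_of_summable (summable_norm_mul_pow a hb)

lemma qPochhammerInf_zero (b : ℂ) : qPochhammerInf 0 b = 1 := by simp [qPochhammerInf]

lemma exists_of_qPochhammerInf_eq_zero {a b : ℂ} (hb : ‖b‖ < 1) (h : qPochhammerInf a b = 0) :
    ∃ n : ℕ, a * b ^ n = 1 := by
  by_contra! hn
  rw [qPochhammerInf_eq] at h
  refine tprod_one_add_ne_zero_of_summable (fun n hn' => hn n ?_) (summable_norm_mul_pow a hb) h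
  linear_combination -hn'

lemma qPochhammerInf_ne_zero {a b : ℂ} (hb : ‖b‖ < 1) (ha : ‖a‖ < 1) : qPochhammerInf a b ≠ 0 := by
  intro h
  obtain ⟨n, hn⟩ := exists_of_qPochhammerInf_eq_zero hb h
  have h1 : ‖a * b ^ n‖ < 1 := by
    rw [norm_mul, norm_pow]
    calc ‖a‖ * ‖b‖ ^ n ≤ ‖a‖ * 1 := by
          gcongr
          exact pow_le_one₀ (norm_nonneg b) hb.le
      _ < 1 := by simpa using ha
  simp [hn] at h1

lemma qPochhammerInf_mul_self (a : ℂ) {b : ℂ} (hb : ‖b‖ < 1) :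
    qPochhammerInf a b = (1 - a) * qPochhammerInf (a * b) b := by
  have hs : Multipliable fun n : ℕ => 1 - a * b ^ (n + 1) := by
    convert multipliable_one_sub_mul_pow (a * b) hb using 2 with n
    ring
  have h := tprod_eq_zero_mul' (f := fun n : ℕ => 1 - a * b ^ n) hs
  simp only [pow_zero, mul_one] at h
  rw [qPochhammerInf, h, qPochhammerInf]
  congr 2 with n
  ring

lemma differentiable_qPochhammerInf {b : ℂ} (hb : ‖b‖ < 1) :
    Differentiable ℂ fun a => qPochhammerInf a b := by
  intro a₀
  have hU : IsOpen (Metric.ball (0 : ℂ) (‖a₀‖ + 1)) := Metric.isOpen_ball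
  have h := ((summable_geometric_of_lt_one (norm_nonneg b) hb).mul_left
    (‖a₀‖ + 1)).hasProdLocallyUniformlyOn_nat_one_add (f := fun n (a : ℂ) => -(a * b ^ n)) hU
    (.of_forall fun n a ha => by
      rw [norm_neg, norm_mul, norm_pow]
      gcongr
      exact (mem_ball_zero_iff.1 ha).le) (fun n => by fun_prop)
  have hd : DifferentiableOn ℂ (fun a => qPochhammerInf a b) (Metric.ball 0 (‖a₀‖ + 1)) := by
    simp_rw [qPochhammerInf_eq]
    exact h.differentiableOn (.of_forall fun _ => by
      simpa [Finset.prod_fn] using DifferentiableOn.finsetProd (fun _ _ => by fun_prop)) hU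
  exact hd.differentiableAt (hU.mem_nhds (by simp))

/-! ### Numerator and denominator -/

/-- The numerator `(q² e^{-2πiz}; q²)_∞`. -/
def gammaNum (τ z : ℂ) : ℂ :=
  qPochhammerInf (exp (2 * Real.pi * I * τ) * exp (-2 * Real.pi * I * z))
      (exp (2 * Real.pi * I * τ))

/-- The denominator `(e^{-2πiz/τ}; q^{-2/τ²})_∞`. -/
def gammaDen (τ z : ℂ) : ℂ :=
  qPochhammerInf (exp (-2 * Real.pi * I * z / τ)) (exp (-2 * Real.pi * I / τ))

lemma tauGammaQuotient_eq (τ z : ℂ) : tauGammaQuotient τ z = gammaNum τ z / gammaDen τ z := rfl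

lemma norm_exp_two_pi_I (w : ℂ) :
    ‖exp (2 * Real.pi * I * w)‖ = Real.exp (-(2 * Real.pi * w.im)) := by
  rw [norm_exp]; simp

lemma norm_exp_neg_two_pi_I (w : ℂ) :
    ‖exp (-2 * Real.pi * I * w)‖ = Real.exp (2 * Real.pi * w.im) := by
  rw [norm_exp]; simp

lemma norm_exp_neg_two_pi_I_div (w τ : ℂ) :
    ‖exp (-2 * Real.pi * I * w / τ)‖ = Real.exp (2 * Real.pi * (w / τ).im) := by
  rw [mul_div_assoc, norm_exp_neg_two_pi_I]

section

variable {τ : ℂ} (hτ : 0 < τ.im)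

include hτ

lemma ne_zero_of_im_pos : τ ≠ 0 := by
  rintro rfl
  simp at hτ

lemma im_one_div_neg : (1 / τ).im < 0 := by
  rw [one_div, inv_im]
  have := normSq_pos.2 (ne_zero_of_im_pos hτ)
  rw [neg_div]
  exact neg_neg_of_pos (by positivity)

lemma norm_nome_lt_one : ‖exp (2 * Real.pi * I * τ)‖ < 1 := by
  rw [norm_exp_two_pi_I, Real.exp_lt_one_iff]
  have := Real.pi_pos
  have : 0 < 2 * Real.pi * τ.im := by positivity
  linarith

lemma norm_dual_nome_lt_one : ‖exp (-2 * Real.pi * I / τ)‖ < 1 := by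
  have := norm_exp_neg_two_pi_I_div 1 τ
  rw [mul_one] at this
  rw [this, Real.exp_lt_one_iff]
  have := im_one_div_neg hτ
  have := Real.pi_pos
  nlinarith

lemma differentiable_gammaNum : Differentiable ℂ (gammaNum τ) := by
  unfold gammaNum
  exact (differentiable_qPochhammerInf (norm_nome_lt_one hτ)).comp (by fun_prop)

lemma differentiable_gammaDen : Differentiable ℂ (gammaDen τ) := by
  unfold gammaDen
  exact (differentiable_qPochhammerInf (norm_dual_nome_lt_one hτ)).comp
    (f := fun z => exp (-2 * Real.pi * I * z / τ)) (by fun_prop)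

omit hτ in
lemma gammaNum_add_one (z : ℂ) : gammaNum τ (z + 1) = gammaNum τ z := by
  have : exp (-2 * Real.pi * I * (z + 1)) = exp (-2 * Real.pi * I * z) := by
    rw [show -2 * Real.pi * I * (z + 1) = -2 * Real.pi * I * z - 2 * Real.pi * I by ring,
      exp_periodic.sub_eq]
  simp only [gammaNum, this]

lemma gammaNum_add_tau (z : ℂ) :
    gammaNum τ (z + τ) = (1 - exp (-2 * Real.pi * I * z)) * gammaNum τ z := by
  have : exp (2 * Real.pi * I * τ) * exp (-2 * Real.pi * I * (z + τ)) =
      exp (-2 * Real.pi * I * z) := by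
    rw [← exp_add]; congr 1; ring
  rw [gammaNum, this, qPochhammerInf_mul_self _ (norm_nome_lt_one hτ), mul_comm (exp (_ * z))]
  rfl

lemma gammaDen_eq_mul_add_one (z : ℂ) :
    gammaDen τ z = (1 - exp (-2 * Real.pi * I * z / τ)) * gammaDen τ (z + 1) := by
  rw [gammaDen, qPochhammerInf_mul_self _ (norm_dual_nome_lt_one hτ), gammaDen, ← exp_add]
  congr 3
  ring

lemma gammaDen_add_tau (z : ℂ) : gammaDen τ (z + τ) = gammaDen τ z := by
  have h0 := ne_zero_of_im_pos hτ
  have : exp (-2 * Real.pi * I * (z + τ) / τ) = exp (-2 * Real.pi * I * z / τ) := by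
    rw [show -2 * Real.pi * I * (z + τ) / τ = -2 * Real.pi * I * z / τ - 2 * Real.pi * I by
      field_simp; ring, exp_periodic.sub_eq]
  simp only [gammaDen, this]

lemma gammaNum_ne_zero {z : ℂ} (hz : z.im < τ.im) : gammaNum τ z ≠ 0 := by
  refine qPochhammerInf_ne_zero (norm_nome_lt_one hτ) ?_
  rw [norm_mul, norm_exp_two_pi_I, norm_exp_neg_two_pi_I, ← Real.exp_add, Real.exp_lt_one_iff]
  nlinarith [Real.pi_pos]

lemma gammaDen_ne_zero {z : ℂ} (hz : (z / τ).im < 0) : gammaDen τ z ≠ 0 := by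
  refine qPochhammerInf_ne_zero (norm_dual_nome_lt_one hτ) ?_
  rw [norm_exp_neg_two_pi_I_div, Real.exp_lt_one_iff]
  nlinarith [Real.pi_pos]

lemma exists_int_of_gammaDen_eq_zero {z : ℂ} (h : gammaDen τ z = 0) :
    ∃ (n : ℕ) (m : ℤ), z = -n + m * τ := by
  have h0 := ne_zero_of_im_pos hτ
  obtain ⟨n, hn⟩ := exists_of_qPochhammerInf_eq_zero (norm_dual_nome_lt_one hτ) h
  rw [← exp_nat_mul, ← exp_add, exp_eq_one_iff] at hn
  obtain ⟨m, hm⟩ := hn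
  refine ⟨n, -m, ?_⟩
  have hpi : (2 * Real.pi * I : ℂ) ≠ 0 := two_pi_I_ne_zero
  field_simp at hm
  push_cast
  have h2 : (2 * Real.pi * I : ℂ) * (z + n + m * τ) = 0 := by linear_combination -2 * Real.pi * I * hm
  have := (mul_eq_zero.1 h2).resolve_left hpi
  linear_combination this

lemma tendsto_gammaNum : Tendsto (gammaNum τ) (comap im atBot) (𝓝 1) := by
  have hc := (differentiable_qPochhammerInf (norm_nome_lt_one hτ)).continuous.tendsto 0
  rw [qPochhammerInf_zero] at hc
  refine hc.comp ?_
  rw [← mul_zero (exp (2 * Real.pi * I * τ))]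
  refine Tendsto.const_mul _ ?_
  rw [tendsto_zero_iff_norm_tendsto_zero]
  simp_rw [norm_exp_neg_two_pi_I]
  exact Real.tendsto_exp_atBot.comp
    ((tendsto_comap (f := im)).const_mul_atBot (by positivity))

lemma tendsto_gammaDen :
    Tendsto (gammaDen τ) (comap (fun z : ℂ => (z / τ).im) atBot) (𝓝 1) := by
  have hc := (differentiable_qPochhammerInf (norm_dual_nome_lt_one hτ)).continuous.tendsto 0
  rw [qPochhammerInf_zero] at hc
  refine hc.comp (f := fun z => exp (-2 * Real.pi * I * z / τ)) ?_
  rw [tendsto_zero_iff_norm_tendsto_zero]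
  simp_rw [norm_exp_neg_two_pi_I_div]
  exact Real.tendsto_exp_atBot.comp
    ((tendsto_comap (f := fun z : ℂ => (z / τ).im)).const_mul_atBot (by positivity))

/-! ### Doubly periodic entire functions -/

/-- The coordinates of a complex number with respect to the basis `1, τ`. -/
lemma exists_eq_add_mul (z : ℂ) : ∃ x y : ℝ, z = x + y * τ := by
  refine ⟨z.re - z.im / τ.im * τ.re, z.im / τ.im, ?_⟩
  apply Complex.ext
  · simp
  · simp [hτ.ne']

omit hτ in
lemma periodic_int {α : Type*} {f : ℂ → α} {w : ℂ} (h : ∀ z, f (z + w) = f z) (m : ℤ) (z : ℂ) :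
    f (z + m * w) = f z := by
  have : Function.Periodic f w := h
  exact this.int_mul m z

/-- All values are taken on a compact fundamental parallelogram, so the function is bounded and
Liouville applies. -/
lemma eq_of_differentiable_of_periodic {f : ℂ → ℂ} (hf : Differentiable ℂ f)
    (h1 : ∀ z, f (z + 1) = f z) (h2 : ∀ z, f (z + τ) = f z) (z w : ℂ) : f z = f w := by
  refine hf.apply_eq_apply_of_bounded ?_ z w
  have hK : IsCompact ((fun p : ℝ × ℝ => f (p.1 + p.2 * τ)) '' (Set.Icc 0 1 ×ˢ Set.Icc 0 1)) :=
    (isCompact_Icc.prod isCompact_Icc).image (hf.continuous.comp (by fun_prop))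
  refine hK.isBounded.subset ?_
  rintro _ ⟨z, rfl⟩
  obtain ⟨x, y, rfl⟩ := exists_eq_add_mul hτ z
  refine ⟨(Int.fract x, Int.fract y), ⟨⟨Int.fract_nonneg _, (Int.fract_lt_one _).le⟩,
    ⟨Int.fract_nonneg _, (Int.fract_lt_one _).le⟩⟩, ?_⟩
  have e1 := periodic_int h1 ⌊x⌋ (Int.fract x + Int.fract y * τ)
  have e2 := periodic_int h2 ⌊y⌋ (Int.fract x + Int.fract y * τ + ⌊x⌋ * 1)
  rw [e1] at e2
  dsimp only
  rw [← e2]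
  congr 1
  have ex : (x : ℂ) = ⌊x⌋ + Int.fract x := by exact_mod_cast (Int.floor_add_fract x).symm
  have ey : (y : ℂ) = ⌊y⌋ + Int.fract y := by exact_mod_cast (Int.floor_add_fract y).symm
  linear_combination -ex - τ * ey

end

end

noncomputable section

/-! ### The inversion formula for the theta products -/

/-- The Gaussian `e^{-iπz(z-1-τ)/τ}`. -/
def gammaPhase (τ z : ℂ) : ℂ := exp (-(Real.pi * I * (z * (z - 1 - τ) / τ)))

lemma gammaPhase_ne_zero (τ z : ℂ) : gammaPhase τ z ≠ 0 := exp_ne_zero _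

lemma differentiable_gammaPhase (τ : ℂ) : Differentiable ℂ (gammaPhase τ) := by
  unfold gammaPhase; fun_prop

/-- The product of the numerators at `z` and `1 + τ - z`. -/
def thetaNum (τ z : ℂ) : ℂ := gammaNum τ z * gammaNum τ (1 + τ - z)

/-- The product of the denominators at `z` and `1 + τ - z`. -/
def thetaDen (τ z : ℂ) : ℂ := gammaDen τ z * gammaDen τ (1 + τ - z)

lemma hasDerivAt_one_sub_exp (τ : ℂ) :
    HasDerivAt (fun z : ℂ => 1 - exp (-2 * Real.pi * I * z / τ)) (2 * Real.pi * I / τ) 0 := by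
  have h : HasDerivAt (fun z : ℂ => -2 * Real.pi * I * z / τ) (-2 * Real.pi * I * 1 / τ) 0 :=
    ((hasDerivAt_id (0 : ℂ)).const_mul _).div_const τ
  refine (h.cexp.const_sub 1).congr_deriv ?_
  rw [mul_zero, zero_div, exp_zero]
  ring

section

variable {τ : ℂ} (hτ : 0 < τ.im)

include hτ

lemma gammaPhase_add_one (z : ℂ) :
    gammaPhase τ (z + 1) = -exp (-2 * Real.pi * I * z / τ) * gammaPhase τ z := by
  have h0 := ne_zero_of_im_pos hτ
  have e : -(Real.pi * I * ((z + 1) * (z + 1 - 1 - τ) / τ)) =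
      -2 * Real.pi * I * z / τ + -(Real.pi * I * (z * (z - 1 - τ) / τ)) + Real.pi * I := by
    field_simp
    ring
  rw [gammaPhase, gammaPhase, e, exp_add, exp_add, exp_pi_mul_I]
  ring

lemma gammaPhase_add_tau (z : ℂ) :
    gammaPhase τ (z + τ) = -exp (-2 * Real.pi * I * z) * gammaPhase τ z := by
  have h0 := ne_zero_of_im_pos hτ
  have e : -(Real.pi * I * ((z + τ) * (z + τ - 1 - τ) / τ)) =
      -2 * Real.pi * I * z + -(Real.pi * I * (z * (z - 1 - τ) / τ)) + Real.pi * I := by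
    field_simp
    ring
  rw [gammaPhase, gammaPhase, e, exp_add, exp_add, exp_pi_mul_I]
  ring

lemma differentiable_thetaNum : Differentiable ℂ (thetaNum τ) :=
  (differentiable_gammaNum hτ).mul ((differentiable_gammaNum hτ).comp (by fun_prop))

lemma differentiable_thetaDen : Differentiable ℂ (thetaDen τ) :=
  (differentiable_gammaDen hτ).mul ((differentiable_gammaDen hτ).comp (by fun_prop))

lemma gammaNum_one_add_tau_sub (z : ℂ) :
    gammaNum τ (1 + τ - z) = (1 - exp (2 * Real.pi * I * z)) * gammaNum τ (-z) := by
  rw [show 1 + τ - z = -z + τ + 1 by ring, gammaNum_add_one, gammaNum_add_tau hτ]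
  congr 3
  ring

lemma gammaDen_one_add_tau_sub (z : ℂ) : gammaDen τ (1 + τ - z) = gammaDen τ (1 - z) := by
  rw [← gammaDen_add_tau hτ (1 - z)]
  congr 1
  ring

omit hτ in
lemma thetaNum_add_one (z : ℂ) : thetaNum τ (z + 1) = thetaNum τ z := by
  rw [thetaNum, thetaNum, gammaNum_add_one, ← gammaNum_add_one (1 + τ - (z + 1))]
  congr 2
  ring

lemma thetaNum_add_tau (z : ℂ) :
    thetaNum τ (z + τ) = -exp (-2 * Real.pi * I * z) * thetaNum τ z := by
  have e : exp (-2 * Real.pi * I * z) * exp (2 * Real.pi * I * z) = 1 := by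
    rw [← exp_add, ← exp_zero]; congr 1; ring
  rw [thetaNum, thetaNum, gammaNum_add_tau hτ, gammaNum_one_add_tau_sub hτ z,
    show 1 + τ - (z + τ) = -z + 1 by ring, gammaNum_add_one]
  linear_combination -gammaNum τ z * gammaNum τ (-z) * e

lemma thetaDen_add_tau (z : ℂ) : thetaDen τ (z + τ) = thetaDen τ z := by
  rw [thetaDen, thetaDen, gammaDen_add_tau hτ, ← gammaDen_add_tau hτ (1 + τ - (z + τ))]
  congr 2
  ring

/-- Splits off the factor that vanishes at the origin; the remaining factor is `gammaDen τ 1 ^ 2 ≠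
0` there, so the zero is simple. -/
lemma thetaDen_eq_mul (z : ℂ) : thetaDen τ z =
    (1 - exp (-2 * Real.pi * I * z / τ)) * (gammaDen τ (z + 1) * gammaDen τ (1 - z)) := by
  rw [thetaDen, gammaDen_one_add_tau_sub hτ, gammaDen_eq_mul_add_one hτ z]
  ring

lemma thetaDen_add_one (z : ℂ) :
    exp (-2 * Real.pi * I * z / τ) * thetaDen τ (z + 1) = -thetaDen τ z := by
  have e : exp (-2 * Real.pi * I * z / τ) * exp (-2 * Real.pi * I * (-z) / τ) = 1 := by
    rw [← exp_add, ← exp_zero]; congr 1; ring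
  rw [thetaDen_eq_mul hτ z, thetaDen, gammaDen_one_add_tau_sub hτ,
    show 1 - (z + 1) = -z by ring, gammaDen_eq_mul_add_one hτ (-z),
    show -z + 1 = 1 - z by ring]
  linear_combination -gammaDen τ (z + 1) * gammaDen τ (1 - z) * e

lemma exists_int_of_thetaDen_eq_zero {z : ℂ} (h : thetaDen τ z = 0) :
    ∃ n m : ℤ, z = n * 1 + m * τ := by
  rcases mul_eq_zero.1 h with h | h
  · obtain ⟨n, m, rfl⟩ := exists_int_of_gammaDen_eq_zero hτ h
    exact ⟨-n, m, by push_cast; ring⟩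
  · obtain ⟨n, m, h⟩ := exists_int_of_gammaDen_eq_zero hτ h
    exact ⟨1 + n, 1 - m, by push_cast; linear_combination -h⟩

lemma deriv_thetaDen_zero_ne : deriv (thetaDen τ) 0 ≠ 0 := by
  have h0 := ne_zero_of_im_pos hτ
  have hM : gammaDen τ 1 ≠ 0 := gammaDen_ne_zero hτ (im_one_div_neg hτ)
  have hd := differentiable_gammaDen hτ
  have e : thetaDen τ = fun z => (1 - exp (-2 * Real.pi * I * z / τ)) *
      (gammaDen τ (z + 1) * gammaDen τ (1 - z)) := funext (thetaDen_eq_mul hτ)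
  have h1 := hasDerivAt_one_sub_exp τ
  have h2 : DifferentiableAt ℂ (fun z => gammaDen τ (z + 1) * gammaDen τ (1 - z)) 0 := by
    have h3 : Differentiable ℂ (fun z => gammaDen τ (z + 1)) := hd.comp (by fun_prop)
    have h4 : Differentiable ℂ (fun z => gammaDen τ (1 - z)) := hd.comp (by fun_prop)
    exact (h3 0).mul (h4 0)
  rw [e, (h1.fun_mul h2.hasDerivAt).deriv]
  simp [hM, h0, Real.pi_ne_zero]

/-- **Inversion of the theta function**, up to a constant. -/
lemma exists_thetaNum_eq :
    ∃ C : ℂ, C ≠ 0 ∧ ∀ z, thetaNum τ z = C * gammaPhase τ z * thetaDen τ z := by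
  have h0 := ne_zero_of_im_pos hτ
  set a : ℂ → ℂ := fun z => thetaNum τ z / gammaPhase τ z with ha
  have hda : Differentiable ℂ a := (differentiable_thetaNum hτ).div
    (differentiable_gammaPhase τ) (gammaPhase_ne_zero τ)
  have hdB := differentiable_thetaDen hτ
  -- The zeros of `thetaDen` are lattice points, and at 0 numerator and denominator both vanish. The
  -- quotient of derivatives is the value that removes this singularity; by periodicity the same
  -- value serves at every zero.
  set f : ℂ → ℂ := fun z => if thetaDen τ z = 0 then deriv a 0 / deriv (thetaDen τ) 0
    else a z / thetaDen τ z with hf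
  have hB1 (z : ℂ) : thetaDen τ (z + 1) = 0 ↔ thetaDen τ z = 0 := by
    have := thetaDen_add_one hτ z
    constructor <;> intro h <;> simpa [h, exp_ne_zero] using this
  have hf1 (z : ℂ) : f (z + 1) = f z := by
    by_cases hz : thetaDen τ z = 0
    · simp [hf, hz, hB1]
    · have hz' := (hB1 z).not.2 hz
      simp only [hf, hz, hz', if_false, ha]
      rw [div_div, div_div, thetaNum_add_one, gammaPhase_add_one hτ]
      congr 1
      linear_combination -gammaPhase τ z * thetaDen_add_one hτ z
  have hf2 (z : ℂ) : f (z + τ) = f z := by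
    simp only [hf, ha, thetaDen_add_tau hτ, thetaNum_add_tau hτ, gammaPhase_add_tau hτ]
    rw [mul_div_mul_left _ _ (neg_ne_zero.2 (exp_ne_zero _))]
  have ha0 : a 0 = 0 := by
    simp only [ha, thetaNum, gammaNum_one_add_tau_sub hτ 0]
    simp
  have hB0 : thetaDen τ 0 = 0 := by simp [thetaDen_eq_mul hτ]
  have hf0 : DifferentiableAt ℂ f 0 := by
    have d1 : Differentiable ℂ (dslope a 0) := by
      rw [← differentiableOn_univ, differentiableOn_dslope univ_mem]
      exact hda.differentiableOn
    have d2 : Differentiable ℂ (dslope (thetaDen τ) 0) := by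
      rw [← differentiableOn_univ, differentiableOn_dslope univ_mem]
      exact hdB.differentiableOn
    have n2 : dslope (thetaDen τ) 0 0 ≠ 0 := by
      rw [dslope_same]; exact deriv_thetaDen_zero_ne hτ
    refine ((d1 0).div (d2 0) n2).congr_of_eventuallyEq ?_
    filter_upwards [d2.continuous.continuousAt.eventually_ne n2] with z hz
    rcases eq_or_ne z 0 with rfl | hz0
    · simp [hf, hB0]
    · have e1 : thetaDen τ z = z * dslope (thetaDen τ) 0 z := by
        simpa [hB0] using (sub_smul_dslope (thetaDen τ) 0 z).symm
      have e2 : a z = z * dslope a 0 z := by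
        simpa [ha0] using (sub_smul_dslope a 0 z).symm
      have e3 : thetaDen τ z ≠ 0 := by rw [e1]; exact mul_ne_zero hz0 hz
      simp only [hf, e3, if_false, Pi.div_apply]
      rw [e1, e2, mul_div_mul_left _ _ hz0]
  have hfd : Differentiable ℂ f := by
    intro z
    by_cases hz : thetaDen τ z = 0
    · obtain ⟨n, m, rfl⟩ := exists_int_of_thetaDen_eq_zero hτ hz
      have hp : f = fun w => f (w - (n * 1 + m * τ)) := by
        funext w
        have e1 := periodic_int hf1 n (w - (n * 1 + m * τ))
        have e2 := periodic_int hf2 m (w - (n * 1 + m * τ) + n * 1)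
        rw [← e1, ← e2]
        congr 1
        ring
      rw [hp]
      refine DifferentiableAt.fun_comp' (g := f) (n * 1 + m * τ) ?_
        (differentiableAt_id.sub_const (n * 1 + m * τ : ℂ))
      simpa using hf0
    · refine ((hda z).div (hdB z) hz).congr_of_eventuallyEq ?_
      filter_upwards [hdB.continuous.continuousAt.eventually_ne hz] with w hw
      simp [hf, hw]
  have hconst := eq_of_differentiable_of_periodic hτ hfd hf1 hf2
  -- The fixed point of z ↦ 1 + τ - z lies in the regions where `gammaNum` and `gammaDen` have no
  -- zeros, so the constant read off there is nonzero.
  set w : ℂ := (1 + τ) / 2 with hw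
  have hu : (w / τ).im = (1 / τ).im / 2 := by
    rw [show w / τ = (1 / τ + 1) / 2 by rw [hw]; field_simp]
    simp
  have hv : w.im = τ.im / 2 := by simp [hw]
  have hu1 := im_one_div_neg hτ
  have hww : 1 + τ - w = w := by rw [hw]; ring
  have hBw : thetaDen τ w ≠ 0 := by
    rw [thetaDen, hww]
    have := gammaDen_ne_zero hτ (z := w) (by linarith)
    exact mul_ne_zero this this
  have hAw : thetaNum τ w ≠ 0 := by
    rw [thetaNum, hww]
    have := gammaNum_ne_zero hτ (z := w) (by linarith)
    exact mul_ne_zero this this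
  refine ⟨f w, ?_, ?_⟩
  · simp only [hf, hBw, if_false, ha]
    exact div_ne_zero (div_ne_zero hAw (gammaPhase_ne_zero τ w)) hBw
  -- At zeros of `thetaDen` the value of `f` carries no direct information, so the identity is
  -- proved near `w` and continued analytically.
  · have han : AnalyticOnNhd ℂ (thetaNum τ) Set.univ :=
      (differentiable_thetaNum hτ).differentiableOn.analyticOnNhd isOpen_univ
    have han' : AnalyticOnNhd ℂ (fun z => f w * gammaPhase τ z * thetaDen τ z) Set.univ :=
      DifferentiableOn.analyticOnNhd (((differentiable_gammaPhase τ).const_mul _).mul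
        hdB).differentiableOn isOpen_univ
    refine fun z => congrFun (han.eq_of_eventuallyEq han' (z₀ := w) ?_) z
    filter_upwards [hdB.continuous.continuousAt.eventually_ne hBw] with z hz
    rw [hconst w z]
    simp only [hf, hz, if_false, ha]
    have := gammaPhase_ne_zero τ z
    field_simp

end

end

noncomputable section

/-! ### The region northeast of the southwestern quarter -/

lemma eventually_ne_zero_nhdsNE {f : ℂ → ℂ} (hf : Differentiable ℂ f) {w : ℂ} (hw : f w ≠ 0)
    (z : ℂ) : ∀ᶠ x in 𝓝[≠] z, f x ≠ 0 := by
  have han : AnalyticOnNhd ℂ f Set.univ := hf.differentiableOn.analyticOnNhd isOpen_univ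
  refine ((han z trivial).eventually_eq_zero_or_eventually_ne_zero).resolve_left fun h => hw ?_
  exact congrFun (han.eq_of_eventuallyEq (g := 0) (analyticOnNhd_const (v := 0)) h) w

section

variable {τ : ℂ} (hτ : 0 < τ.im)

include hτ

/-- In coordinates z = x + yτ one has Im(z/τ) = x Im(1/τ) with Im(1/τ) < 0, and Im z = y Im τ, so
the two conditions are x > 0 and y > 0. -/
lemma notMem_southwestClosed_iff {z : ℂ} :
    z ∉ southwestClosed τ ↔ (z / τ).im < 0 ∨ 0 < z.im := by
  have h0 := ne_zero_of_im_pos hτ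
  have h1 := im_one_div_neg hτ
  have key (x y : ℝ) : ((x + y * τ) / τ).im = x * (1 / τ).im ∧ (x + y * τ : ℂ).im = y * τ.im := by
    rw [show ((x + y * τ) / τ : ℂ) = x * (1 / τ) + y by field_simp]
    constructor
    · rw [add_im, im_ofReal_mul, ofReal_im, add_zero]
    · simp
  obtain ⟨x, y, rfl⟩ := exists_eq_add_mul hτ z
  rw [(key x y).1, (key x y).2]
  constructor
  · intro h
    by_contra! hc
    refine h ⟨-x, -y, ?_, ?_, by push_cast; ring⟩
    · nlinarith [hc.1]
    · nlinarith [hc.2]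
  · rintro h ⟨x', y', hx, hy, he⟩
    have k := key x y
    rw [he, show (-x' - y' * τ : ℂ) = ((-x' : ℝ) : ℂ) + ((-y' : ℝ) : ℂ) * τ by push_cast; ring,
      (key (-x') (-y')).1, (key (-x') (-y')).2] at k
    rw [← k.1, ← k.2] at h
    rcases h with h | h <;> nlinarith

lemma im_neg_of_mem_southeast {d : ℂ} (hd : d ∈ southeast τ) : d.im < 0 := by
  obtain ⟨x, y, hx, hy, rfl⟩ := hd
  simp [hy, hτ]

lemma im_div_neg_of_mem_southeast {d : ℂ} (hd : d ∈ southeast τ) : (d / τ).im < 0 := by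
  have h0 := ne_zero_of_im_pos hτ
  obtain ⟨x, y, hx, hy, rfl⟩ := hd
  rw [show ((x - y * τ) / τ : ℂ) = x * (1 / τ) - y by field_simp, sub_im, im_ofReal_mul,
    ofReal_im, sub_zero]
  exact mul_neg_of_pos_of_neg hx (im_one_div_neg hτ)

/-! ### The values of the `γ`-function -/

lemma meromorphicOn_tauGammaQuotient : MeromorphicOn (tauGammaQuotient τ) Set.univ := by
  intro z _
  exact ((differentiable_gammaNum hτ).analyticAt z).meromorphicAt.div
    ((differentiable_gammaDen hτ).analyticAt z).meromorphicAt

omit hτ in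
lemma meromorphicNFAt_tauGamma (z : ℂ) : MeromorphicNFAt (tauGamma τ) z :=
  meromorphicNFOn_toMeromorphicNFOn _ _ (Set.mem_univ z)

lemma tauGamma_eventuallyEq (z : ℂ) : tauGamma τ =ᶠ[𝓝[≠] z] tauGammaQuotient τ :=
  (meromorphicOn_tauGammaQuotient hτ).toMeromorphicNFOn_eq_self_on_nhdsNE (Set.mem_univ z)

lemma tauGamma_eq_of_eventuallyEq {g : ℂ → ℂ} {z : ℂ} (hg : AnalyticAt ℂ g z)
    (h : ∀ᶠ w in 𝓝[≠] z, tauGammaQuotient τ w = g w) : tauGamma τ z = g z :=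
  (((meromorphicNFAt_tauGamma z).eventuallyEq_nhdsNE_iff_eventuallyEq_nhds
    hg.meromorphicNFAt).1 ((tauGamma_eventuallyEq hτ z).trans h)).eq_of_nhds

/-- The inverse of a meromorphic normal form is again in normal form, so this also computes the
reciprocal at poles of γ, where it is 0. -/
lemma tauGamma_inv_eq_of_eventuallyEq {g : ℂ → ℂ} {z : ℂ} (hg : AnalyticAt ℂ g z)
    (h : ∀ᶠ w in 𝓝[≠] z, (tauGammaQuotient τ w)⁻¹ = g w) : (tauGamma τ z)⁻¹ = g z :=
  (((meromorphicNFAt_tauGamma z).inv.eventuallyEq_nhdsNE_iff_eventuallyEq_nhds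
    hg.meromorphicNFAt).1 ((tauGamma_eventuallyEq hτ z).inv.trans h)).eq_of_nhds

lemma eventually_gammaNum_ne_zero (z : ℂ) : ∀ᶠ w in 𝓝[≠] z, gammaNum τ w ≠ 0 :=
  eventually_ne_zero_nhdsNE (differentiable_gammaNum hτ)
    (gammaNum_ne_zero hτ (z := 0) (by simpa using hτ)) z

lemma eventually_gammaDen_ne_zero (z : ℂ) : ∀ᶠ w in 𝓝[≠] z, gammaDen τ w ≠ 0 :=
  eventually_ne_zero_nhdsNE (differentiable_gammaDen hτ)
    (gammaDen_ne_zero hτ (z := 1) (im_one_div_neg hτ)) z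

lemma differentiable_gammaNum_refl : Differentiable ℂ fun z => gammaNum τ (1 + τ - z) :=
  (differentiable_gammaNum hτ).comp (by fun_prop)

lemma differentiable_gammaDen_refl : Differentiable ℂ fun z => gammaDen τ (1 + τ - z) :=
  (differentiable_gammaDen hτ).comp (by fun_prop)

lemma eventually_gammaNum_refl_ne_zero (z : ℂ) :
    ∀ᶠ w in 𝓝[≠] z, gammaNum τ (1 + τ - w) ≠ 0 :=
  eventually_ne_zero_nhdsNE (differentiable_gammaNum_refl hτ) (w := 1 + τ)
    (by simpa using gammaNum_ne_zero hτ (z := 0) (by simpa using hτ)) z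

lemma eventually_gammaDen_refl_ne_zero (z : ℂ) :
    ∀ᶠ w in 𝓝[≠] z, gammaDen τ (1 + τ - w) ≠ 0 :=
  eventually_ne_zero_nhdsNE (differentiable_gammaDen_refl hτ) (w := τ)
    (by simpa using gammaDen_ne_zero hτ (z := 1) (im_one_div_neg hτ)) z

lemma im_div_refl (z : ℂ) : ((1 + τ - z) / τ).im = (1 / τ).im - (z / τ).im := by
  have h0 := ne_zero_of_im_pos hτ
  rw [show (1 + τ - z) / τ = 1 / τ + 1 - z / τ by field_simp]
  simp

omit hτ in
lemma im_refl (z : ℂ) : (1 + τ - z).im = τ.im - z.im := by simp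

lemma gammaNum_refl_ne_zero {z : ℂ} (hz : 0 < z.im) : gammaNum τ (1 + τ - z) ≠ 0 :=
  gammaNum_ne_zero hτ (by rw [im_refl]; linarith)

lemma tauGamma_eq_of_gammaDen_ne_zero {z : ℂ} (hz : gammaDen τ z ≠ 0) :
    tauGamma τ z = gammaNum τ z / gammaDen τ z :=
  tauGamma_eq_of_eventuallyEq hτ (((differentiable_gammaNum hτ).analyticAt z).div
    ((differentiable_gammaDen hτ).analyticAt z) hz) (.of_forall fun _ => rfl)

/-- `gammaDen τ z` may vanish in this half-plane; the theta inversion trades it for `gammaNum τ (1 +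
τ - z)`, which does not. This exhibits the singularities there as removable. -/
lemma tauGamma_eq_of_im_pos {C : ℂ}
    (hC : ∀ z, thetaNum τ z = C * gammaPhase τ z * thetaDen τ z) {z : ℂ} (hz : 0 < z.im) :
    tauGamma τ z =
      C * gammaPhase τ z * (gammaDen τ (1 + τ - z) / gammaNum τ (1 + τ - z)) := by
  refine tauGamma_eq_of_eventuallyEq hτ
    (g := fun z => C * gammaPhase τ z * (gammaDen τ (1 + τ - z) / gammaNum τ (1 + τ - z)))
    (AnalyticAt.mul (((differentiable_gammaPhase τ).const_mul C).analyticAt z)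
      (((differentiable_gammaDen_refl hτ).analyticAt z).div
        ((differentiable_gammaNum_refl hτ).analyticAt z) (gammaNum_refl_ne_zero hτ hz))) ?_
  filter_upwards [eventually_gammaDen_ne_zero hτ z, eventually_gammaNum_refl_ne_zero hτ z]
    with w h1 h2
  have := hC w
  rw [thetaNum, thetaDen] at this
  rw [tauGammaQuotient_eq]
  field_simp
  linear_combination this

/-- The function `ζ ↦ 1 / γ(1 + τ - ζ)`. -/
def recipGamma (τ ζ : ℂ) : ℂ := (tauGamma τ (1 + τ - ζ))⁻¹

omit hτ in
lemma tauGammaIntegrand_eq (z ζ : ℂ) : tauGammaIntegrand τ z ζ =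
    exp (2 * Real.pi * I * ζ * z / τ) * recipGamma τ ζ := by
  rw [tauGammaIntegrand, recipGamma, div_eq_mul_inv]

lemma recipGamma_eq_of_im_pos {z : ℂ} (hz : 0 < z.im) :
    recipGamma τ z = gammaDen τ (1 + τ - z) / gammaNum τ (1 + τ - z) := by
  refine tauGamma_inv_eq_of_eventuallyEq hτ (g := fun w => gammaDen τ w / gammaNum τ w)
    (((differentiable_gammaDen hτ).analyticAt _).div
      ((differentiable_gammaNum hτ).analyticAt _) (gammaNum_refl_ne_zero hτ hz)) ?_
  refine .of_forall fun w => ?_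
  rw [tauGammaQuotient_eq, inv_div]

/-- Here `gammaNum τ (1 + τ - z)` may vanish, and the theta inversion replaces it. The phase it
introduces is the Gaussian that governs the southeastern end. -/
lemma recipGamma_eq_of_im_div_neg {C : ℂ} (hC0 : C ≠ 0)
    (hC : ∀ z, thetaNum τ z = C * gammaPhase τ z * thetaDen τ z) {z : ℂ} (hz : (z / τ).im < 0) :
    recipGamma τ z = (C * gammaPhase τ z)⁻¹ * (gammaNum τ z / gammaDen τ z) := by
  have key := tauGamma_inv_eq_of_eventuallyEq hτ (z := 1 + τ - z) (g := fun w =>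
    (C * gammaPhase τ (1 + τ - w))⁻¹ * (gammaNum τ (1 + τ - w) / gammaDen τ (1 + τ - w)))
  rw [sub_sub_cancel] at key
  refine key ?_ ?_
  · have hd : Differentiable ℂ fun w => C * gammaPhase τ (1 + τ - w) :=
      ((differentiable_gammaPhase τ).comp (by fun_prop)).const_mul C
    refine ((hd.analyticAt _).inv (mul_ne_zero hC0 (gammaPhase_ne_zero _ _))).mul
      (((differentiable_gammaNum_refl hτ).analyticAt _).div
        ((differentiable_gammaDen_refl hτ).analyticAt _) ?_)
    rw [sub_sub_cancel]
    exact gammaDen_ne_zero hτ hz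
  · filter_upwards [eventually_gammaNum_ne_zero hτ (1 + τ - z),
      eventually_gammaDen_refl_ne_zero hτ (1 + τ - z)] with w h1 h2
    have := hC (1 + τ - w)
    have h3 := gammaPhase_ne_zero τ (1 + τ - w)
    rw [thetaNum, thetaDen, sub_sub_cancel] at this
    rw [tauGammaQuotient_eq]
    field_simp
    linear_combination -this

omit hτ in
lemma isOpen_im_div_neg : IsOpen {z : ℂ | (z / τ).im < 0} :=
  isOpen_lt (by fun_prop) continuous_const

omit hτ in
lemma isOpen_im_pos : IsOpen {z : ℂ | 0 < z.im} :=
  isOpen_lt continuous_const (by fun_prop)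

lemma isOpen_compl_southwestClosed : IsOpen (southwestClosed τ)ᶜ := by
  have : (southwestClosed τ)ᶜ = {z | (z / τ).im < 0} ∪ {z | 0 < z.im} :=
    Set.ext fun z => notMem_southwestClosed_iff hτ
  rw [this]
  exact isOpen_im_div_neg.union isOpen_im_pos

lemma differentiableAt_tauGamma {z : ℂ} (hz : z ∉ southwestClosed τ) :
    DifferentiableAt ℂ (tauGamma τ) z := by
  obtain ⟨C, -, hC⟩ := exists_thetaNum_eq hτ
  rcases (notMem_southwestClosed_iff hτ).1 hz with hz | hz
  · have h := (differentiable_gammaNum hτ z).div (differentiable_gammaDen hτ z)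
      (gammaDen_ne_zero hτ hz)
    refine h.congr_of_eventuallyEq ?_
    filter_upwards [isOpen_im_div_neg.mem_nhds hz] with w hw
    exact tauGamma_eq_of_gammaDen_ne_zero hτ (gammaDen_ne_zero hτ hw)
  · have h := ((differentiable_gammaPhase τ).const_mul C z).mul
      ((differentiable_gammaDen_refl hτ z).div (differentiable_gammaNum_refl hτ z)
        (gammaNum_refl_ne_zero hτ hz))
    refine h.congr_of_eventuallyEq ?_
    filter_upwards [isOpen_im_pos.mem_nhds hz] with w hw
    exact tauGamma_eq_of_im_pos hτ hC hw

lemma differentiableAt_recipGamma {z : ℂ} (hz : z ∉ southwestClosed τ) :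
    DifferentiableAt ℂ (recipGamma τ) z := by
  obtain ⟨C, hC0, hC⟩ := exists_thetaNum_eq hτ
  rcases (notMem_southwestClosed_iff hτ).1 hz with hz | hz
  · have h := (((differentiable_gammaPhase τ).const_mul C z).inv
      (mul_ne_zero hC0 (gammaPhase_ne_zero _ _))).mul
      ((differentiable_gammaNum hτ z).div (differentiable_gammaDen hτ z)
      (gammaDen_ne_zero hτ hz))
    refine h.congr_of_eventuallyEq ?_
    filter_upwards [isOpen_im_div_neg.mem_nhds hz] with w hw
    exact recipGamma_eq_of_im_div_neg hτ hC0 hC hw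
  · have h := (differentiable_gammaDen_refl hτ z).div (differentiable_gammaNum_refl hτ z)
        (gammaNum_refl_ne_zero hτ hz)
    refine h.congr_of_eventuallyEq ?_
    filter_upwards [isOpen_im_pos.mem_nhds hz] with w hw
    exact recipGamma_eq_of_im_pos hτ hw

/-! ### Difference equations of ζ ↦ 1/γ(1+τ-ζ) -/

lemma im_add_one_div_lt {z : ℂ} : ((z + 1) / τ).im < (z / τ).im := by
  rw [add_div, add_im]
  linarith [im_one_div_neg hτ]

lemma im_add_tau_div {z : ℂ} : ((z + τ) / τ).im = (z / τ).im := by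
  rw [add_div, div_self (ne_zero_of_im_pos hτ)]
  simp

/-- The shift preserves each of the two half-planes, so each explicit form can be compared with its
own translate. In the first, the phase contributes the factor that turns 1 - e^{-2πiz/τ} into 1 -
e^{2πiz/τ}. -/
lemma recipGamma_add_one {z : ℂ} (hz : z ∉ southwestClosed τ) :
    recipGamma τ (z + 1) = (1 - exp (2 * Real.pi * I * z / τ)) * recipGamma τ z := by
  have e : exp (-2 * Real.pi * I * z / τ) * exp (2 * Real.pi * I * z / τ) = 1 := by
    rw [← exp_add, ← exp_zero]; congr 1; ring
  obtain ⟨C, hC0, hC⟩ := exists_thetaNum_eq hτ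
  rcases (notMem_southwestClosed_iff hτ).1 hz with hz | hz
  · have hz1 := (im_add_one_div_lt hτ (z := z)).trans hz
    have h1 := gammaDen_ne_zero hτ hz
    have h2 := gammaDen_ne_zero hτ hz1
    have h3 := gammaPhase_ne_zero τ z
    have h4 := gammaDen_eq_mul_add_one hτ z
    have h5 : exp (-2 * Real.pi * I * z / τ) ≠ 0 := exp_ne_zero _
    rw [recipGamma_eq_of_im_div_neg hτ hC0 hC hz, recipGamma_eq_of_im_div_neg hτ hC0 hC hz1,
      gammaPhase_add_one hτ, gammaNum_add_one]
    generalize exp (-2 * Real.pi * I * z / τ) = v at *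
    generalize exp (2 * Real.pi * I * z / τ) = w at *
    field_simp
    rw [h4]
    linear_combination gammaNum τ z * gammaDen τ (z + 1) * e
  · have hz1 : 0 < (z + 1).im := by simpa using hz
    rw [recipGamma_eq_of_im_pos hτ hz, recipGamma_eq_of_im_pos hτ hz1,
      show 1 + τ - (z + 1) = -z + τ by ring, gammaDen_add_tau hτ, gammaDen_eq_mul_add_one hτ (-z),
      ← gammaNum_add_one (-z + τ), ← gammaDen_add_tau hτ (-z + 1),
      show -z + τ + 1 = 1 + τ - z by ring, show -z + 1 + τ = 1 + τ - z by ring,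
      show -2 * Real.pi * I * -z / τ = 2 * Real.pi * I * z / τ by ring, mul_div_assoc]

lemma recipGamma_add_tau {z : ℂ} (hz : z ∉ southwestClosed τ) :
    recipGamma τ (z + τ) = (1 - exp (2 * Real.pi * I * z)) * recipGamma τ z := by
  have e : exp (-2 * Real.pi * I * z) * exp (2 * Real.pi * I * z) = 1 := by
    rw [← exp_add, ← exp_zero]; congr 1; ring
  obtain ⟨C, hC0, hC⟩ := exists_thetaNum_eq hτ
  rcases (notMem_southwestClosed_iff hτ).1 hz with hz | hz
  · have hz1 : ((z + τ) / τ).im < 0 := by rwa [im_add_tau_div hτ]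
    have h1 := gammaDen_ne_zero hτ hz
    have h3 := gammaPhase_ne_zero τ z
    have h5 : exp (-2 * Real.pi * I * z) ≠ 0 := exp_ne_zero _
    rw [recipGamma_eq_of_im_div_neg hτ hC0 hC hz, recipGamma_eq_of_im_div_neg hτ hC0 hC hz1,
      gammaPhase_add_tau hτ, gammaNum_add_tau hτ, gammaDen_add_tau hτ]
    generalize exp (-2 * Real.pi * I * z) = v at *
    generalize exp (2 * Real.pi * I * z) = w at *
    field_simp
    linear_combination gammaNum τ z * e
  · have hz1 : 0 < (z + τ).im := by rw [add_im]; linarith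
    have h1 := gammaNum_refl_ne_zero hτ hz
    have h2 := gammaNum_refl_ne_zero hτ hz1
    have h3 := gammaNum_one_add_tau_sub hτ z
    have h4 : gammaNum τ (-z) = gammaNum τ (1 + τ - (z + τ)) := by
      rw [← gammaNum_add_one (-z)]; congr 1; ring
    have h5 : gammaDen τ (1 + τ - (z + τ)) = gammaDen τ (1 + τ - z) := by
      rw [← gammaDen_add_tau hτ (1 + τ - (z + τ))]; congr 1; ring
    rw [h4] at h3
    rw [recipGamma_eq_of_im_pos hτ hz, recipGamma_eq_of_im_pos hτ hz1, h5]
    rw [h3] at h1 ⊢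
    have h6 := left_ne_zero_of_mul h1
    generalize exp (2 * Real.pi * I * z) = w at *
    field_simp

/-! ### Asymptotics -/

lemma exists_norm_recipGamma_sub_one_le {ε : ℝ} (hε : 0 < ε) :
    ∃ R : ℝ, 0 < R ∧ ∀ z : ℂ, R ≤ z.im → R ≤ (z / τ).im → ‖recipGamma τ z - 1‖ ≤ ε := by
  have t1 : Tendsto (fun z => gammaDen τ (1 + τ - z))
      (comap (fun z : ℂ => (z / τ).im) atTop) (𝓝 1) := by
    refine (tendsto_gammaDen hτ).comp (tendsto_comap_iff.2 ?_)
    simp only [Function.comp_def, im_div_refl hτ]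
    exact tendsto_atBot_add_const_left _ _ (tendsto_neg_atTop_atBot.comp tendsto_comap)
  have t2 : Tendsto (fun z => gammaNum τ (1 + τ - z)) (comap im atTop) (𝓝 1) := by
    refine (tendsto_gammaNum hτ).comp (tendsto_comap_iff.2 ?_)
    simp only [Function.comp_def, im_refl]
    exact tendsto_atBot_add_const_left _ _ (tendsto_neg_atTop_atBot.comp tendsto_comap)
  have t3 := (t1.mono_left inf_le_left).div (t2.mono_left inf_le_right) one_ne_zero
  rw [div_one] at t3
  have t4 := t3.eventually (Metric.closedBall_mem_nhds _ hε)
  rw [((atTop_basis.comap _).inf (atTop_basis.comap _)).eventually_iff] at t4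
  obtain ⟨⟨r, s⟩, -, h⟩ := t4
  refine ⟨max 1 (max r s), by positivity, fun z h1 h2 => ?_⟩
  have hz : 0 < z.im := lt_of_lt_of_le (by positivity) h1
  rw [recipGamma_eq_of_im_pos hτ hz]
  have := @h z ⟨(le_max_left r s).trans ((le_max_right 1 _).trans h2),
    (le_max_right r s).trans ((le_max_right 1 _).trans h1)⟩
  rwa [dist_eq_norm] at this

/-- The quotient `gammaNum τ z / gammaDen τ z` tends to 1 and is eventually bounded by 2; only the
inverse phase remains. -/
lemma exists_norm_recipGamma_le : ∃ K R : ℝ, 0 < K ∧ 0 < R ∧ ∀ z : ℂ, z.im ≤ -R →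
    (z / τ).im ≤ -R →
    ‖recipGamma τ z‖ ≤ K * Real.exp (-(Real.pi * (z * (z - 1 - τ) / τ).im)) := by
  obtain ⟨C, hC0, hC⟩ := exists_thetaNum_eq hτ
  have t1 := (tendsto_gammaDen hτ).mono_left
    (inf_le_left : _ ⊓ comap im atBot ≤ _)
  have t2 := (tendsto_gammaNum hτ).mono_left
    (inf_le_right : comap (fun z : ℂ => (z / τ).im) atBot ⊓ _ ≤ _)
  have t3 := t2.div t1 one_ne_zero
  rw [div_one] at t3
  have t4 := t3.eventually (Metric.closedBall_mem_nhds _ one_pos)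
  rw [((atBot_basis.comap _).inf (atBot_basis.comap _)).eventually_iff] at t4
  obtain ⟨⟨r, s⟩, -, h⟩ := t4
  refine ⟨‖C‖⁻¹ * 2, max 1 (max (-r) (-s)), by positivity, by positivity, fun z h1 h2 => ?_⟩
  have b1 := le_max_left 1 (max (-r) (-s))
  have b2 := (le_max_left (-r) (-s)).trans (le_max_right 1 _)
  have b3 := (le_max_right (-r) (-s)).trans (le_max_right 1 _)
  have hz : (z / τ).im < 0 := by linarith
  rw [recipGamma_eq_of_im_div_neg hτ hC0 hC hz]
  have := @h z ⟨show (z / τ).im ≤ r by linarith, show z.im ≤ s by linarith⟩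
  rw [dist_eq_norm] at this
  have hb : ‖gammaNum τ z / gammaDen τ z‖ ≤ 2 := by
    have := norm_le_norm_add_norm_sub' (gammaNum τ z / gammaDen τ z) 1
    rw [norm_one] at this
    simp only [Pi.div_apply] at *
    linarith
  have hp : ‖(gammaPhase τ z)⁻¹‖ = Real.exp (-(Real.pi * (z * (z - 1 - τ) / τ).im)) := by
    rw [gammaPhase, ← exp_neg, neg_neg, norm_exp, mul_assoc, re_ofReal_mul, I_mul_re]
    ring_nf
  rw [norm_mul, mul_inv, norm_mul, hp, norm_inv]
  calc _ ≤ ‖C‖⁻¹ * Real.exp (-(Real.pi * (z * (z - 1 - τ) / τ).im)) * 2 := by gcongr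
    _ = _ := by ring

/-! ### The residue at the origin -/

/-- The pole comes from the factor 1 - e^{-2πiz/τ} of the denominator, whose derivative at 0 is
2πi/τ. The other factors give N(0)/D(1), which is γ(1) because N has period 1. -/
lemma tendsto_mul_tauGamma :
    Tendsto (fun z : ℂ => 2 * Real.pi * I / τ * (z * tauGamma τ z)) (𝓝[≠] 0)
      (𝓝 (tauGamma τ 1)) := by
  have h0 := ne_zero_of_im_pos hτ
  have hM : gammaDen τ 1 ≠ 0 := gammaDen_ne_zero hτ (im_one_div_neg hτ)
  have hd := hasDerivAt_one_sub_exp τ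
  have hc : 2 * Real.pi * I / τ ≠ 0 := div_ne_zero two_pi_I_ne_zero h0
  have t1 := (hasDerivAt_iff_tendsto_slope.1 hd).inv₀ hc
  have t2 : Tendsto (fun z => gammaNum τ z / gammaDen τ (z + 1)) (𝓝[≠] 0)
      (𝓝 (gammaNum τ 0 / gammaDen τ (0 + 1))) := by
    have : ContinuousAt (fun z => gammaNum τ z / gammaDen τ (z + 1)) 0 :=
      (differentiable_gammaNum hτ).continuous.continuousAt.div
        ((differentiable_gammaDen hτ).continuous.comp (by fun_prop)).continuousAt
        (by simpa using hM)
    exact this.mono_left nhdsWithin_le_nhds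
  have t3 := (t1.mul t2).const_mul (2 * Real.pi * I / τ)
  rw [← mul_assoc, mul_inv_cancel₀ hc, one_mul, ← gammaNum_add_one 0, zero_add,
    ← tauGamma_eq_of_gammaDen_ne_zero hτ hM] at t3
  refine t3.congr' ?_
  filter_upwards [eventually_gammaDen_ne_zero hτ 0, self_mem_nhdsWithin] with z hz hz0
  have hz0 : z ≠ 0 := hz0
  have e := gammaDen_eq_mul_add_one hτ z
  rw [tauGamma_eq_of_gammaDen_ne_zero hτ hz, slope_def_field, e]
  rw [e] at hz
  have hz1 := left_ne_zero_of_mul hz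
  have hz2 := right_ne_zero_of_mul hz
  simp only [mul_zero, zero_div, exp_zero, sub_self, sub_zero]
  field_simp

end

end

noncomputable section

/-! ### Primitives and integrals along lines -/

lemma convex_im_div (τ : ℂ) : Convex ℝ {z : ℂ | (z / τ).im < 0} :=
  convex_halfSpace_lt (f := fun z : ℂ => (z / τ).im)
    ⟨fun x y => by simp [add_div], fun a x => by
      rw [smul_div_assoc, smul_im]⟩ 0

lemma convex_im_pos : Convex ℝ {z : ℂ | 0 < z.im} :=
  convex_halfSpace_gt (f := Complex.im) ⟨by simp, by simp⟩ 0

/-- Half-planes are convex. The multiplier `k` lets one statement serve Im w, Im(w/τ) and Im(wz/τ).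
-/
lemma le_im_mul_of_mem_segment {p q w : ℂ} (hw : w ∈ segment ℝ p q) {r : ℝ} (k : ℂ)
    (hp : r ≤ (p * k).im) (hq : r ≤ (q * k).im) : r ≤ (w * k).im := by
  have : Convex ℝ {z : ℂ | r ≤ (z * k).im} :=
    convex_halfSpace_ge (f := fun z : ℂ => (z * k).im)
      ⟨fun x y => by simp only [add_mul, add_im], fun a x => by
        rw [smul_mul_assoc, smul_im]⟩ r
  exact this.segment_subset hp hq hw

/-- The real 1-form f dz is closed because its derivative is complex linear, so the Poincaré lemma
on a convex set applies. -/
lemma exists_primitive_of_convex {U : Set ℂ} (hU : Convex ℝ U) (hUo : IsOpen U) {f : ℂ → ℂ}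
    (hf : DifferentiableOn ℂ f U) : ∃ P : ℂ → ℂ, ∀ z ∈ U, HasDerivAt P (f z) z := by
  set ω : ℂ → ℂ →L[ℂ] ℂ := fun z => ContinuousLinearMap.toSpanSingleton ℂ (f z) with hω
  have hd (z : ℂ) (hz : z ∈ U) : HasFDerivAt ω
      (((ContinuousLinearMap.toSpanSingletonCLE (𝕜 := ℂ) (E := ℂ)).toContinuousLinearMap ∘L
        (fderiv ℂ f z)).restrictScalars ℝ) z := by
    have h1 := (hf.differentiableAt (hUo.mem_nhds hz)).hasFDerivAt
    exact (((ContinuousLinearMap.toSpanSingletonCLE (𝕜 := ℂ) (E := ℂ)).hasFDerivAt).comp z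
      h1).restrictScalars ℝ
  obtain ⟨P, hP⟩ := hU.exists_forall_hasFDerivAt_of_fderiv_symmetric hUo (ω := ω)
    (fun z hz => (hd z hz).differentiableAt.differentiableWithinAt) (fun z hz x y => by
      rw [(hd z hz).fderiv]
      simp [fderiv_eq_smul_deriv]
      ring)
  refine ⟨P, fun z hz => ?_⟩
  have := (hP z hz).hasDerivAt
  simpa [hω] using this

section

variable {τ : ℂ} (hτ : 0 < τ.im)

include hτ

/-- The region is not convex, but it is the union of two convex half-planes with convex
intersection. Primitives on the two differ by a constant on the overlap and can be glued. -/
lemma exists_primitive {f : ℂ → ℂ} (hf : ∀ z ∉ southwestClosed τ, DifferentiableAt ℂ f z) :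
    ∃ P : ℂ → ℂ, ∀ z ∉ southwestClosed τ, HasDerivAt P (f z) z := by
  have hU := isOpen_im_div_neg (τ := τ)
  have hV := isOpen_im_pos
  obtain ⟨P, hP⟩ := exists_primitive_of_convex (convex_im_div τ) hU (f := f) fun z hz =>
    (hf z ((notMem_southwestClosed_iff hτ).2 (.inl hz))).differentiableWithinAt
  obtain ⟨Q, hQ⟩ := exists_primitive_of_convex convex_im_pos hV (f := f) fun z hz =>
    (hf z ((notMem_southwestClosed_iff hτ).2 (.inr hz))).differentiableWithinAt
  set w : ℂ := 1 + τ with hw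
  have hw1 : (w / τ).im < 0 := by
    rw [im_add_tau_div hτ]; exact im_one_div_neg hτ
  have hw2 : 0 < w.im := by simpa [hw] using hτ
  have heq : Set.EqOn P (fun z => Q z + (P w - Q w)) ({z | (z / τ).im < 0} ∩ {z | 0 < z.im}) := by
    refine (hU.inter hV).eqOn_of_deriv_eq
      ((convex_im_div τ).inter convex_im_pos).isPreconnected
      (fun z hz => (hP z hz.1).differentiableAt.differentiableWithinAt)
      (fun z hz => ((hQ z hz.2).add_const _).differentiableAt.differentiableWithinAt)
      (fun z hz => ?_) (x := w) ⟨hw1, hw2⟩ (by ring)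
    rw [(hP z hz.1).deriv, ((hQ z hz.2).add_const _).deriv]
  classical
  refine ⟨fun z => if (z / τ).im < 0 then P z else Q z + (P w - Q w), fun z hz => ?_⟩
  rcases (notMem_southwestClosed_iff hτ).1 hz with hz | hz
  · refine (hP z hz).congr_of_eventuallyEq ?_
    filter_upwards [hU.mem_nhds hz] with x hx
    exact if_pos hx
  · refine ((hQ z hz).add_const (P w - Q w)).congr_of_eventuallyEq ?_
    filter_upwards [hV.mem_nhds hz] with x hx
    split_ifs with h
    · exact heq ⟨h, hx⟩
    · rfl

end

lemma norm_sub_le_of_segment {f P : ℂ → ℂ} {p q : ℂ} {M : ℝ}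
    (hP : ∀ w ∈ segment ℝ p q, HasDerivAt P (f w) w) (hM : ∀ w ∈ segment ℝ p q, ‖f w‖ ≤ M) :
    ‖P q - P p‖ ≤ M * ‖q - p‖ :=
  Convex.norm_image_sub_le_of_norm_hasDerivWithin_le (fun w hw => (hP w hw).hasDerivWithinAt) hM
    (convex_segment p q) (left_mem_segment ℝ p q) (right_mem_segment ℝ p q)

lemma integrable_of_exp_decay {g : ℝ → ℂ} (hg : Continuous g) {M ε : ℝ} (hε : 0 < ε)
    (h1 : ∀ᶠ t : ℝ in atTop, ‖g t‖ ≤ M * Real.exp (-(ε * t)))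
    (h2 : ∀ᶠ t : ℝ in atTop, ‖g (-t)‖ ≤ M * Real.exp (-(ε * t))) : Integrable g := by
  have key (k : ℝ → ℂ) (hk : Continuous k)
      (h : ∀ᶠ t : ℝ in atTop, ‖k t‖ ≤ M * Real.exp (-(ε * t))) :
      IntegrableOn k (Set.Ici 0) := by
    have h3 : IntegrableOn (fun t => ‖k t‖) (Set.Ioi 0) := by
      refine integrable_of_isBigO_exp_neg hε hk.norm.continuousOn (.of_bound M ?_)
      filter_upwards [h] with t ht
      simpa using ht
    rw [integrableOn_Ici_iff_integrableOn_Ioi]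
    exact (integrable_norm_iff hk.aestronglyMeasurable).1 h3
  have e1 := key g hg h1
  have e2 := (key (fun t => g (-t)) (hg.comp continuous_neg) h2).comp_neg
  simp only [neg_neg, Set.neg_Ici, neg_zero] at e2
  rw [← integrableOn_univ, ← Set.Iic_union_Ici (a := (0 : ℝ))]
  exact e2.union e1

lemma tendsto_affine_mul_exp (A B : ℝ) {ε : ℝ} (hε : 0 < ε) :
    Tendsto (fun t : ℝ => Real.exp (-(ε * t)) * (A + B * t)) atTop (𝓝 0) := by
  have h0 := (tendsto_rpow_mul_exp_neg_mul_atTop_nhds_zero 0 ε hε).const_mul A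
  have h1 := (tendsto_rpow_mul_exp_neg_mul_atTop_nhds_zero 1 ε hε).const_mul B
  have h2 := h0.add h1
  rw [mul_zero, mul_zero, add_zero] at h2
  refine h2.congr fun t => ?_
  rw [Real.rpow_zero, Real.rpow_one, neg_mul]
  ring

lemma tendsto_const_add_mul (a : ℝ) {b : ℝ} (hb : 0 < b) :
    Tendsto (fun t : ℝ => a + t * b) atTop atTop :=
  tendsto_atTop_add_const_left _ _ (tendsto_id.atTop_mul_const hb)

namespace NWSELine

variable {τ : ℂ} (c : NWSELine τ)

/-- The function `f` decays exponentially along both ends of the line. -/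
def Decays (f : ℂ → ℂ) : Prop :=
  ∃ M ε : ℝ, 0 < M ∧ 0 < ε ∧
    (∀ᶠ t : ℝ in atTop, ‖f (c.toFun t)‖ ≤ M * Real.exp (-(ε * t))) ∧
    ∀ᶠ t : ℝ in atTop, ‖f (c.toFun (-t))‖ ≤ M * Real.exp (-(ε * t))

variable {c} {f : ℂ → ℂ}

lemma continuous_comp (c : NWSELine τ) (hf : ∀ z ∉ southwestClosed τ, DifferentiableAt ℂ f z) :
    Continuous fun t => f (c.toFun t) :=
  continuous_iff_continuousAt.2 fun t =>
    (hf _ (c.avoids t)).continuousAt.comp c.continuous_toFun.continuousAt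

lemma integrable_deriv_mul (c : NWSELine τ) {g : ℝ → ℂ} (hg : Integrable g) :
    Integrable fun t => deriv c.toFun t * g t := by
  obtain ⟨K, hK⟩ := c.bounded_deriv
  refine hg.bdd_mul (c := K) (stronglyMeasurable_deriv _).aestronglyMeasurable ?_
  have : ∀ᵐ t : ℝ, t ∉ (c.corners : Set ℝ) :=
    (c.corners.finite_toSet.countable).ae_notMem _
  filter_upwards [this] with t ht
  exact hK t (by simpa using ht)

lemma Decays.integrable (h : c.Decays f)
    (hf : ∀ z ∉ southwestClosed τ, DifferentiableAt ℂ f z) : Integrable (c.pullback f) := by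
  obtain ⟨M, ε, -, hε, h1, h2⟩ := h
  exact c.integrable_deriv_mul (integrable_of_exp_decay (c.continuous_comp hf) hε h1 h2)

lemma intervalIntegral_eq (hi : Integrable (c.pullback f)) {P : ℂ → ℂ}
    (hP : ∀ z ∉ southwestClosed τ, HasDerivAt P (f z) z) {a b : ℝ} (hab : a ≤ b) :
    ∫ t in a..b, c.pullback f t = P (c.toFun b) - P (c.toFun a) := by
  refine integral_eq_of_hasDerivAt_off_countable_of_le (fun t => P (c.toFun t)) _ hab
    (s := c.corners) c.corners.finite_toSet.countable
    (c.continuous_comp fun z hz => (hP z hz).differentiableAt).continuousOn (fun t ht => ?_)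
    hi.intervalIntegrable
  have h1 := (c.differentiableAt_toFun t (by simpa using ht.2)).hasDerivAt
  exact ((hP _ (c.avoids t)).comp_of_eq t h1 rfl).congr_deriv (mul_comm _ _)

lemma exists_tendsto_primitive (hi : Integrable (c.pullback f)) {P : ℂ → ℂ}
    (hP : ∀ z ∉ southwestClosed τ, HasDerivAt P (f z) z) :
    ∃ A B : ℂ, Tendsto (fun t => P (c.toFun t)) atTop (𝓝 A) ∧
      Tendsto (fun t => P (c.toFun (-t))) atTop (𝓝 B) ∧ c.integral f = A - B := by
  have h1 := intervalIntegral_tendsto_integral_Ioi 0 hi.integrableOn tendsto_id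
  have h2 := intervalIntegral_tendsto_integral_Iic 0 hi.integrableOn tendsto_neg_atTop_atBot
  refine ⟨(∫ t in Set.Ioi 0, c.pullback f t) + P (c.toFun 0),
    P (c.toFun 0) - ∫ t in Set.Iic 0, c.pullback f t, ?_, ?_, ?_⟩
  · refine (h1.add_const (P (c.toFun 0))).congr' ?_
    filter_upwards [eventually_ge_atTop 0] with t ht
    rw [id, intervalIntegral_eq hi hP ht]
    ring
  · refine (h2.const_sub (P (c.toFun 0))).congr' ?_
    filter_upwards [eventually_ge_atTop 0] with t ht
    rw [intervalIntegral_eq hi hP (by simpa using ht)]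
    ring
  · rw [integral, ← intervalIntegral.integral_Iic_add_Ioi (b := 0) hi.integrableOn hi.integrableOn]
    ring

lemma eventually_toFun_eq (c : NWSELine τ) :
    ∀ᶠ t : ℝ in atTop, c.toFun t = c.baseSE + t * c.dirSE := by
  filter_upwards [eventually_ge_atTop c.T] with t ht using c.eq_SE t ht

lemma eventually_toFun_neg_eq (c : NWSELine τ) :
    ∀ᶠ t : ℝ in atTop, c.toFun (-t) = c.baseNW - t * c.dirNW := by
  filter_upwards [eventually_ge_atTop c.T] with t ht
  rw [c.eq_NW (-t) (by linarith)]
  push_cast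
  ring

end NWSELine

end

noncomputable section

/-! ### Decay of the integrand -/

/-- The Gaussian phase of the integrand at the southeastern end. -/
def gaussPhase (τ z ζ : ℂ) : ℝ := (ζ * (ζ + 2 * z - 1 - τ) / τ).im

lemma norm_exp_integrand (τ z ζ : ℂ) :
    ‖exp (2 * Real.pi * I * ζ * z / τ)‖ = Real.exp (-(2 * Real.pi * (ζ * (z / τ)).im)) := by
  rw [← norm_exp_two_pi_I]
  congr 2
  ring

lemma im_sub_mul (a d k : ℂ) (t : ℝ) : ((a - t * d) * k).im = (a * k).im + t * -(d * k).im := by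
  rw [sub_mul, sub_im, mul_assoc, im_ofReal_mul]
  ring

lemma im_add_mul (a d k : ℂ) (t : ℝ) : ((a + t * d) * k).im = (a * k).im + t * (d * k).im := by
  rw [add_mul, add_im, mul_assoc, im_ofReal_mul]

section

variable {τ : ℂ} (hτ : 0 < τ.im)

include hτ

lemma differentiableAt_tauGammaIntegrand (z : ℂ) {ζ : ℂ} (hζ : ζ ∉ southwestClosed τ) :
    DifferentiableAt ℂ (tauGammaIntegrand τ z) ζ := by
  have : tauGammaIntegrand τ z = fun ζ => exp (2 * Real.pi * I * ζ * z / τ) * recipGamma τ ζ :=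
    funext (tauGammaIntegrand_eq z)
  rw [this]
  exact DifferentiableAt.fun_mul (by fun_prop) (differentiableAt_recipGamma hτ hζ)

lemma exists_norm_integrand_le_northwest : ∃ R : ℝ, 0 < R ∧ ∀ z ζ : ℂ, R ≤ (ζ * 1).im →
    R ≤ (ζ * τ⁻¹).im →
    ‖tauGammaIntegrand τ z ζ‖ ≤ 2 * Real.exp (-(2 * Real.pi * (ζ * (z / τ)).im)) := by
  obtain ⟨R, hR, h⟩ := exists_norm_recipGamma_sub_one_le hτ one_pos
  refine ⟨R, hR, fun z ζ h1 h2 => ?_⟩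
  have h3 := h ζ (by simpa using h1) h2
  have h4 := norm_le_norm_add_norm_sub' (recipGamma τ ζ) 1
  rw [norm_one] at h4
  rw [tauGammaIntegrand_eq, norm_mul, norm_exp_integrand, mul_comm]
  gcongr
  linarith

lemma exists_norm_integrand_le_southeast : ∃ K R : ℝ, 0 < K ∧ 0 < R ∧ ∀ z ζ : ℂ, ζ.im ≤ -R →
    (ζ / τ).im ≤ -R →
    ‖tauGammaIntegrand τ z ζ‖ ≤ K * Real.exp (-(Real.pi * gaussPhase τ z ζ)) := by
  obtain ⟨K, R, hK, hR, h⟩ := exists_norm_recipGamma_le hτ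
  refine ⟨K, R, hK, hR, fun z ζ h1 h2 => ?_⟩
  have h3 := h ζ h1 h2
  have e : gaussPhase τ z ζ = 2 * (ζ * (z / τ)).im + (ζ * (ζ - 1 - τ) / τ).im := by
    rw [gaussPhase, ← im_ofReal_mul, ← add_im]
    congr 1
    push_cast
    ring
  rw [tauGammaIntegrand_eq, norm_mul, norm_exp_integrand]
  calc _ ≤ Real.exp (-(2 * Real.pi * (ζ * (z / τ)).im)) *
        (K * Real.exp (-(Real.pi * (ζ * (ζ - 1 - τ) / τ).im))) := by gcongr
    _ = K * Real.exp (-(Real.pi * gaussPhase τ z ζ)) := by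
      rw [mul_left_comm, ← Real.exp_add, e]
      ring_nf

lemma eventually_northwest {d : ℂ} (hd : d ∈ southeast τ) (a : ℂ) (R : ℝ) :
    ∀ᶠ t : ℝ in atTop, R ≤ ((a - t * d) * 1).im ∧ R ≤ ((a - t * d) * τ⁻¹).im := by
  simp_rw [im_sub_mul]
  have h1 := im_neg_of_mem_southeast hτ hd
  have h2 := im_div_neg_of_mem_southeast hτ hd
  refine ((tendsto_const_add_mul _ ?_).eventually_ge_atTop R).and
    ((tendsto_const_add_mul _ ?_).eventually_ge_atTop R)
  · simpa using h1
  · rw [← div_eq_mul_inv]; linarith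

lemma eventually_southeast {d : ℂ} (hd : d ∈ southeast τ) (b : ℂ) (R : ℝ) :
    ∀ᶠ t : ℝ in atTop, (b + t * d).im ≤ -R ∧ ((b + t * d) / τ).im ≤ -R := by
  filter_upwards [eventually_northwest hτ hd (-b) R] with t ht
  constructor
  · have := ht.1
    rw [mul_one, show -b - t * d = -(b + t * d) by ring, neg_im] at this
    linarith
  · have := ht.2
    rw [← div_eq_mul_inv, show -b - t * d = -(b + t * d) by ring, neg_div, neg_im] at this
    linarith

omit hτ in
-- Along the ray the phase is a quadratic polynomial in t with leading coefficient Im(d²/τ). When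
-- that vanishes, the linear coefficient is the second quantity in the hypothesis.
lemma exists_le_gaussPhase {z b d : ℂ} (h : 0 < (d ^ 2 / τ).im ∨
      ((d ^ 2 / τ).im = 0 ∧ 0 < (d * (2 * b + 2 * z - 1 - τ) / τ).im)) :
    ∃ ε M : ℝ, 0 < ε ∧ ∀ᶠ t : ℝ in atTop, ε * t + M ≤ gaussPhase τ z (b + t * d) := by
  set A := (d ^ 2 / τ).im with hA
  set B := (d * (2 * b + 2 * z - 1 - τ) / τ).im with hB
  have e (t : ℝ) : gaussPhase τ z (b + t * d) = t * (B + t * A) + gaussPhase τ z b := by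
    rw [gaussPhase, gaussPhase, hA, hB, ← im_ofReal_mul t (_ / τ), ← add_im, ← im_ofReal_mul,
      ← add_im]
    congr 1
    ring
  simp_rw [e]
  rcases h with h | ⟨h1, h2⟩
  · refine ⟨1, gaussPhase τ z b, one_pos, ?_⟩
    filter_upwards [(tendsto_const_add_mul B h).eventually_ge_atTop 1, eventually_ge_atTop 0]
      with t ht ht0
    nlinarith
  · refine ⟨B, gaussPhase τ z b, h2, .of_forall fun t => ?_⟩
    rw [h1]
    linarith

lemma exists_decay_northwest {z a d : ℂ} (hd : d ∈ southeast τ) (hdz : (d * z / τ).im < 0) :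
    ∃ M ε : ℝ, 0 < M ∧ 0 < ε ∧
      ∀ᶠ t : ℝ in atTop, ‖tauGammaIntegrand τ z (a - t * d)‖ ≤ M * Real.exp (-(ε * t)) := by
  obtain ⟨R, -, h⟩ := exists_norm_integrand_le_northwest hτ
  have hpi := Real.pi_pos
  rw [mul_div_assoc] at hdz
  refine ⟨2 * Real.exp (-(2 * Real.pi * (a * (z / τ)).im)), 2 * Real.pi * -(d * (z / τ)).im,
    by positivity, mul_pos (by positivity) (by linarith), ?_⟩
  filter_upwards [eventually_northwest hτ hd a R] with t ht
  refine (h z _ ht.1 ht.2).trans (le_of_eq ?_)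
  rw [im_sub_mul, mul_assoc (2 : ℝ) (Real.exp _), ← Real.exp_add]
  ring_nf

lemma exists_decay_southeast {z b d : ℂ} (hd : d ∈ southeast τ) (h : 0 < (d ^ 2 / τ).im ∨
      ((d ^ 2 / τ).im = 0 ∧ 0 < (d * (2 * b + 2 * z - 1 - τ) / τ).im)) :
    ∃ M ε : ℝ, 0 < M ∧ 0 < ε ∧
      ∀ᶠ t : ℝ in atTop, ‖tauGammaIntegrand τ z (b + t * d)‖ ≤ M * Real.exp (-(ε * t)) := by
  obtain ⟨K, R, hK, -, hb⟩ := exists_norm_integrand_le_southeast hτ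
  obtain ⟨ε, M, hε, h⟩ := exists_le_gaussPhase h
  have hpi := Real.pi_pos
  refine ⟨K * Real.exp (-(Real.pi * M)), Real.pi * ε, by positivity, by positivity, ?_⟩
  filter_upwards [eventually_southeast hτ hd b R, h] with t ht h
  refine (hb z _ ht.1 ht.2).trans ?_
  rw [mul_assoc, ← Real.exp_add]
  gcongr
  nlinarith

lemma NWSELine.Suits.decays {c : NWSELine τ} {z : ℂ} (hc : c.Suits z) :
    c.Decays (tauGammaIntegrand τ z) := by
  obtain ⟨M, ε, hM, hε, h⟩ := exists_decay_southeast hτ c.dirSE_mem hc.2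
  obtain ⟨M', ε', hM', hε', h'⟩ := exists_decay_northwest hτ (a := c.baseNW) c.dirNW_mem hc.1
  refine ⟨max M M', min ε ε', by positivity, by positivity, ?_, ?_⟩
  · filter_upwards [h, c.eventually_toFun_eq, eventually_ge_atTop 0] with t h1 h2 h3
    rw [h2]
    refine h1.trans ?_
    gcongr
    · exact le_max_left _ _
    · exact min_le_left _ _
  · filter_upwards [h', c.eventually_toFun_neg_eq, eventually_ge_atTop 0] with t h1 h2 h3
    rw [h2]
    refine h1.trans ?_
    gcongr
    · exact le_max_right _ _
    · exact min_le_right _ _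

lemma NWSELine.Suits.integrable {c : NWSELine τ} {z : ℂ} (hc : c.Suits z) :
    Integrable (c.pullback (tauGammaIntegrand τ z)) :=
  (hc.decays hτ).integrable fun _ => differentiableAt_tauGammaIntegrand hτ z

/-! ### Independence of the line -/

omit hτ in
-- The segments grow at most linearly in length while `f` decays exponentially on them.
lemma tendsto_sub_of_segment {f P : ℂ → ℂ} (hP : ∀ z ∉ southwestClosed τ, HasDerivAt P (f z) z)
    {p q : ℝ → ℂ} {M ε : ℝ} (hε : 0 < ε)
    (h : ∀ᶠ t : ℝ in atTop, ∀ w ∈ segment ℝ (p t) (q t), w ∉ southwestClosed τ ∧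
      ‖f w‖ ≤ M * Real.exp (-(ε * t)))
    {a d : ℂ} (hl : ∀ t : ℝ, q t - p t = a + t * d) :
    Tendsto (fun t => P (q t) - P (p t)) atTop (𝓝 0) := by
  refine squeeze_zero_norm' (a := fun t => M * (Real.exp (-(ε * t)) * (‖a‖ + ‖d‖ * t))) ?_ ?_
  · filter_upwards [h, eventually_ge_atTop 0] with t ht ht0
    have h1 := norm_sub_le_of_segment (fun w hw => hP w (ht w hw).1) (fun w hw => (ht w hw).2)
    refine h1.trans ?_
    have hM : 0 ≤ M * Real.exp (-(ε * t)) :=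
      (norm_nonneg _).trans (ht _ (left_mem_segment ℝ _ _)).2
    rw [← mul_assoc, hl]
    gcongr
    refine (norm_add_le _ _).trans ?_
    rw [norm_mul, norm_real, Real.norm_of_nonneg ht0, mul_comm t]
  · simpa using (tendsto_affine_mul_exp ‖a‖ ‖d‖ hε).const_mul M

lemma notMem_southwestClosed_of_northwest {R : ℝ} (hR : 0 < R) {w : ℂ} (h : R ≤ (w * 1).im) :
    w ∉ southwestClosed τ :=
  (notMem_southwestClosed_iff hτ).2 (.inr (by rw [mul_one] at h; linarith))

lemma tendsto_sub_northwest {z a d a' d' : ℂ} (hd : d ∈ southeast τ) (hd' : d' ∈ southeast τ)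
    (hz : (d * z / τ).im < 0) (hz' : (d' * z / τ).im < 0) {P : ℂ → ℂ}
    (hP : ∀ ζ ∉ southwestClosed τ, HasDerivAt P (tauGammaIntegrand τ z ζ) ζ) :
    Tendsto (fun t : ℝ => P (a' - t * d') - P (a - t * d)) atTop (𝓝 0) := by
  obtain ⟨R, hR, hb⟩ := exists_norm_integrand_le_northwest hτ
  have hpi := Real.pi_pos
  rw [mul_div_assoc] at hz hz'
  set ε := min (-(d * (z / τ)).im) (-(d' * (z / τ)).im) with hε
  have hε0 : 0 < ε := lt_min (by linarith) (by linarith)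
  set m := min (a * (z / τ)).im (a' * (z / τ)).im with hm
  refine tendsto_sub_of_segment hP (ε := 2 * Real.pi * ε) (by positivity)
    (M := 2 * Real.exp (-(2 * Real.pi * m))) ?_ (a := a' - a) (d := d - d')
    (fun t => by ring)
  filter_upwards [eventually_northwest hτ hd a R, eventually_northwest hτ hd' a' R,
    eventually_ge_atTop 0] with t h1 h2 ht w hw
  have b1 := le_im_mul_of_mem_segment hw 1 h1.1 h2.1
  have b2 := le_im_mul_of_mem_segment hw τ⁻¹ h1.2 h2.2
  have b3 : m + t * ε ≤ (w * (z / τ)).im := by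
    refine le_im_mul_of_mem_segment hw (z / τ) ?_ ?_ <;> rw [im_sub_mul]
    · gcongr
      · exact min_le_left _ _
      · exact min_le_left _ _
    · gcongr
      · exact min_le_right _ _
      · exact min_le_right _ _
  refine ⟨notMem_southwestClosed_of_northwest hτ hR b1, (hb z w b1 b2).trans ?_⟩
  rw [mul_assoc (2 : ℝ) (Real.exp _), ← Real.exp_add]
  gcongr
  nlinarith

lemma gaussPhase_sub_mul_tau {z q : ℂ} {s : ℝ} (hs : 0 ≤ s)
    (hq : 2 * q.im + 2 * z.im - τ.im ≤ 0) : gaussPhase τ z q ≤ gaussPhase τ z (q - s * τ) := by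
  have h0 := ne_zero_of_im_pos hτ
  have e : gaussPhase τ z (q - s * τ) =
      gaussPhase τ z q - s * (2 * q.im + 2 * z.im - τ.im) + s ^ 2 * τ.im := by
    have e1 : (q - s * τ) * (q - s * τ + 2 * z - 1 - τ) / τ = q * (q + 2 * z - 1 - τ) / τ -
        (s : ℂ) * (2 * q + 2 * z - 1 - τ) + ((s ^ 2 : ℝ) : ℂ) * τ := by
      push_cast
      field_simp
      ring
    rw [gaussPhase, gaussPhase, e1, add_im, sub_im, im_ofReal_mul, im_ofReal_mul]
    simp
  rw [e]
  nlinarith [mul_nonneg hs (neg_nonneg.2 hq), mul_nonneg (sq_nonneg s) hτ.le]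

/-- On a segment parallel to τ, every point is reached from the upper endpoint by moving along -τ.
Far enough down this does not lower the phase, so the bound at the upper endpoint suffices. -/
lemma gaussPhase_le_of_mem_segment {z p q w : ℂ} (hpq : (p / τ).im = (q / τ).im)
    (hp : 2 * p.im + 2 * z.im - τ.im ≤ 0) (hq : 2 * q.im + 2 * z.im - τ.im ≤ 0) {L : ℝ}
    (hLp : L ≤ gaussPhase τ z p) (hLq : L ≤ gaussPhase τ z q) (hw : w ∈ segment ℝ p q) :
    L ≤ gaussPhase τ z w := by
  have h0 := ne_zero_of_im_pos hτ
  set r : ℝ := ((q - p) / τ).re with hr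
  have e : q - p = r * τ := by
    rw [← div_eq_iff h0]
    apply Complex.ext
    · simp [hr]
    · rw [sub_div, sub_im, hpq, sub_self, ofReal_im]
  obtain ⟨x, y, hx, hy, hxy, rfl⟩ := hw
  have hxy' : (x : ℂ) + y = 1 := by exact_mod_cast hxy
  simp only [real_smul]
  rcases le_total r 0 with hr0 | hr0
  · have e1 : (x * p + y * q : ℂ) = p - ((y * -r : ℝ) : ℂ) * τ := by
      push_cast
      linear_combination p * hxy' + y * e
    rw [e1]
    exact hLp.trans (gaussPhase_sub_mul_tau hτ (mul_nonneg hy (by linarith)) hp)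
  · have e1 : (x * p + y * q : ℂ) = q - ((x * r : ℝ) : ℂ) * τ := by
      push_cast
      linear_combination q * hxy' - x * e
    rw [e1]
    exact hLq.trans (gaussPhase_sub_mul_tau hτ (mul_nonneg hx hr0) hq)

lemma notMem_southwestClosed_of_southeast {R : ℝ} (hR : 0 < R) {w : ℂ} (h : (w / τ).im ≤ -R) :
    w ∉ southwestClosed τ :=
  (notMem_southwestClosed_iff hτ).2 (.inl (by linarith))

omit hτ in
lemma im_le_of_mem_segment {p q w : ℂ} (hw : w ∈ segment ℝ p q) {r : ℝ} (k : ℂ)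
    (hp : (p * k).im ≤ r) (hq : (q * k).im ≤ r) : (w * k).im ≤ r := by
  have := le_im_mul_of_mem_segment hw (-k) (r := -r) (by simpa using hp) (by simpa using hq)
  simpa using this

lemma tendsto_sub_southeast {z b d b' d' : ℂ} (hd : d ∈ southeast τ) (hd' : d' ∈ southeast τ)
    (hz : 0 < (d ^ 2 / τ).im ∨
      ((d ^ 2 / τ).im = 0 ∧ 0 < (d * (2 * b + 2 * z - 1 - τ) / τ).im))
    (hz' : 0 < (d' ^ 2 / τ).im ∨
      ((d' ^ 2 / τ).im = 0 ∧ 0 < (d' * (2 * b' + 2 * z - 1 - τ) / τ).im)) {P : ℂ → ℂ}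
    (hP : ∀ ζ ∉ southwestClosed τ, HasDerivAt P (tauGammaIntegrand τ z ζ) ζ) :
    ∃ x y : ℝ, 0 < y ∧ Tendsto (fun t : ℝ => P (b' + ((x + t * y : ℝ) : ℂ) * d') - P (b + t * d))
      atTop (𝓝 0) := by
  obtain ⟨K, R, hK, hR, hb⟩ := exists_norm_integrand_le_southeast hτ
  obtain ⟨ε, M, hε, h⟩ := exists_le_gaussPhase hz
  obtain ⟨ε', M', hε', h'⟩ := exists_le_gaussPhase hz'
  have hpi := Real.pi_pos
  have hu := im_div_neg_of_mem_southeast hτ hd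
  have hu' := im_div_neg_of_mem_southeast hτ hd'
  -- The second ray is reparametrized so that corresponding points have equal Im(·/τ); the
  -- connecting segments are then parallel to τ.
  set y := (d / τ).im / (d' / τ).im with hy
  set x := ((b / τ).im - (b' / τ).im) / (d' / τ).im with hx
  have hy0 : 0 < y := div_pos_of_neg_of_neg hu hu'
  refine ⟨x, y, hy0, ?_⟩
  have hσ := tendsto_const_add_mul x hy0
  set m := min M (ε' * x + M')
  set δ := min ε (ε' * y)
  have hδ : 0 < δ := by positivity
  -- Beyond |Im z| the sign condition 2 Im p + 2 Im z - Im τ ≤ 0 holds at both endpoints.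
  set S := max R |z.im|
  refine tendsto_sub_of_segment hP (ε := Real.pi * δ) (by positivity)
    (M := K * Real.exp (-(Real.pi * m))) ?_ (a := b' + x * d' - b) (d := y * d' - d)
    (fun t => by push_cast; ring)
  filter_upwards [eventually_southeast hτ hd b S, hσ.eventually (eventually_southeast hτ hd' b' S),
    eventually_ge_atTop 0, h, hσ.eventually h'] with t h1 h2 ht h3 h4 w hw
  have hSR : R ≤ S := le_max_left _ _
  have hSz : z.im ≤ S := (le_abs_self _).trans (le_max_right _ _)
  have b1 : w.im ≤ -S := by
    simpa using im_le_of_mem_segment hw 1 (by simpa using h1.1) (by simpa using h2.1)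
  have b2 : (w / τ).im ≤ -S := im_le_of_mem_segment hw τ⁻¹ h1.2 h2.2
  have hpq : ((b + t * d) / τ).im = ((b' + ((x + t * y : ℝ) : ℂ) * d') / τ).im := by
    rw [div_eq_mul_inv, div_eq_mul_inv, im_add_mul, im_add_mul]
    simp only [← div_eq_mul_inv]
    have hy' : y * (d' / τ).im = (d / τ).im := div_mul_cancel₀ _ hu'.ne
    have hx' : x * (d' / τ).im = (b / τ).im - (b' / τ).im := div_mul_cancel₀ _ hu'.ne
    linear_combination -hx' - t * hy'
  have b3 : m + t * δ ≤ gaussPhase τ z w := by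
    refine gaussPhase_le_of_mem_segment hτ hpq (by linarith [h1.1]) (by linarith [h2.1])
      (le_trans ?_ h3) (le_trans ?_ h4) hw
    · have e1 : m ≤ M := min_le_left _ _
      have e2 : δ ≤ ε := min_le_left _ _
      nlinarith
    · have e1 : m ≤ ε' * x + M' := min_le_right _ _
      have e2 : δ ≤ ε' * y := min_le_right _ _
      nlinarith
  refine ⟨notMem_southwestClosed_of_southeast hτ hR (b2.trans (by linarith)),
    (hb z w (by linarith) (by linarith)).trans ?_⟩
  rw [mul_assoc, ← Real.exp_add]
  gcongr
  nlinarith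

lemma NWSELine.integral_eq_of_suits {c c' : NWSELine τ} {z : ℂ} (hc : c.Suits z)
    (hc' : c'.Suits z) :
    c.integral (tauGammaIntegrand τ z) = c'.integral (tauGammaIntegrand τ z) := by
  obtain ⟨P, hP⟩ := exists_primitive hτ fun _ => differentiableAt_tauGammaIntegrand hτ z
  obtain ⟨A, B, hA, hB, e⟩ := exists_tendsto_primitive (hc.integrable hτ) hP
  obtain ⟨A', B', hA', hB', e'⟩ := exists_tendsto_primitive (hc'.integrable hτ) hP
  obtain ⟨x, y, hy, hSE⟩ :=
    tendsto_sub_southeast hτ c.dirSE_mem c'.dirSE_mem hc.2 hc'.2 hP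
  have hNW := tendsto_sub_northwest hτ (a := c.baseNW) (a' := c'.baseNW) c.dirNW_mem
    c'.dirNW_mem hc.1 hc'.1 hP
  have hσ := tendsto_const_add_mul x hy
  have h1 : A' - A = 0 := by
    refine tendsto_nhds_unique (((hA'.comp hσ).sub hA).congr' ?_) hSE
    filter_upwards [c.eventually_toFun_eq, hσ.eventually c'.eventually_toFun_eq] with t h1 h2
    simp only [Function.comp_apply, h1, h2]
  have h2 : B' - B = 0 := by
    refine tendsto_nhds_unique ((hB'.sub hB).congr' ?_) hNW
    filter_upwards [c.eventually_toFun_neg_eq, c'.eventually_toFun_neg_eq] with t h1 h2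
    rw [h1, h2]
  rw [e, e']
  linear_combination h2 - h1

end

end

noncomputable section

/-! ### Lines with one corner -/

namespace NWSELine

variable {τ : ℂ}

/-- A curve through `1 + τ` which is straight before and after that point. -/
def bentCurve (τ d₁ d₂ : ℂ) (t : ℝ) : ℂ :=
  1 + τ + ((min t 0 : ℝ) : ℂ) * d₁ + ((max t 0 : ℝ) : ℂ) * d₂

lemma bentCurve_of_nonpos (τ d₁ d₂ : ℂ) {t : ℝ} (ht : t ≤ 0) :
    bentCurve τ d₁ d₂ t = 1 + τ + t * d₁ := by
  simp [bentCurve, ht]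

lemma bentCurve_of_nonneg (τ d₁ d₂ : ℂ) {t : ℝ} (ht : 0 ≤ t) :
    bentCurve τ d₁ d₂ t = 1 + τ + t * d₂ := by
  simp [bentCurve, ht]

lemma hasDerivAt_affine (a d : ℂ) (t : ℝ) : HasDerivAt (fun t : ℝ => a + t * d) d t := by
  simpa using ((hasDerivAt_id t).ofReal_comp.mul_const d).const_add a

lemma hasDerivAt_bentCurve_of_neg (τ d₁ d₂ : ℂ) {t : ℝ} (ht : t < 0) :
    HasDerivAt (bentCurve τ d₁ d₂) d₁ t := by
  refine (hasDerivAt_affine (1 + τ) d₁ t).congr_of_eventuallyEq ?_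
  filter_upwards [Iio_mem_nhds ht] with s hs using bentCurve_of_nonpos _ _ _ (le_of_lt hs)

lemma hasDerivAt_bentCurve_of_pos (τ d₁ d₂ : ℂ) {t : ℝ} (ht : 0 < t) :
    HasDerivAt (bentCurve τ d₁ d₂) d₂ t := by
  refine (hasDerivAt_affine (1 + τ) d₂ t).congr_of_eventuallyEq ?_
  filter_upwards [Ioi_mem_nhds ht] with s hs using bentCurve_of_nonneg _ _ _ (le_of_lt hs)

/-- The line which comes from northwest in the direction `d₁` and turns at `1 + τ` into the
direction `d₂`. -/
def bent (hτ : 0 < τ.im) {d₁ d₂ : ℂ} (h₁ : d₁ ∈ southeast τ) (h₂ : d₂ ∈ southeast τ) :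
    NWSELine τ where
  toFun := bentCurve τ d₁ d₂
  continuous_toFun := by unfold bentCurve; fun_prop
  corners := {0}
  differentiableAt_toFun t ht := by
    rcases lt_or_gt_of_ne (Finset.notMem_singleton.1 ht) with h | h
    · exact (hasDerivAt_bentCurve_of_neg τ d₁ d₂ h).differentiableAt
    · exact (hasDerivAt_bentCurve_of_pos τ d₁ d₂ h).differentiableAt
  continuousOn_deriv := by
    refine continuousOn_of_forall_continuousAt fun t ht => ?_
    rcases lt_or_gt_of_ne (Finset.notMem_singleton.1 ht) with h | h
    · refine (continuousAt_const (y := d₁)).congr ?_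
      filter_upwards [Iio_mem_nhds h] with s hs
      exact (hasDerivAt_bentCurve_of_neg τ d₁ d₂ hs).deriv.symm
    · refine (continuousAt_const (y := d₂)).congr ?_
      filter_upwards [Ioi_mem_nhds h] with s hs
      exact (hasDerivAt_bentCurve_of_pos τ d₁ d₂ hs).deriv.symm
  bounded_deriv := by
    refine ⟨max ‖d₁‖ ‖d₂‖, fun t ht => ?_⟩
    rcases lt_or_gt_of_ne (Finset.notMem_singleton.1 ht) with h | h
    · rw [(hasDerivAt_bentCurve_of_neg τ d₁ d₂ h).deriv]
      exact le_max_left _ _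
    · rw [(hasDerivAt_bentCurve_of_pos τ d₁ d₂ h).deriv]
      exact le_max_right _ _
  T := 0
  baseNW := 1 + τ
  dirNW := d₁
  baseSE := 1 + τ
  dirSE := d₂
  dirNW_mem := h₁
  dirSE_mem := h₂
  eq_NW t ht := bentCurve_of_nonpos _ _ _ (by simpa using ht)
  eq_SE t ht := bentCurve_of_nonneg _ _ _ ht
  avoids t := by
    rw [notMem_southwestClosed_iff hτ]
    rcases le_total t 0 with h | h
    · right
      rw [bentCurve_of_nonpos _ _ _ h, add_im, im_ofReal_mul]
      have := im_neg_of_mem_southeast hτ h₁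
      have : (1 + τ).im = τ.im := by simp
      nlinarith
    · left
      rw [bentCurve_of_nonneg _ _ _ h, add_div, add_im, mul_div_assoc, im_ofReal_mul,
        im_add_tau_div hτ]
      have := im_div_neg_of_mem_southeast hτ h₂
      have := im_one_div_neg hτ
      nlinarith

/-- The translate of a line. -/
def shift (c : NWSELine τ) (w : ℂ) (hw : ∀ z ∉ southwestClosed τ, z + w ∉ southwestClosed τ) :
    NWSELine τ where
  toFun t := c.toFun t + w
  continuous_toFun := c.continuous_toFun.add_const w
  corners := c.corners
  differentiableAt_toFun t ht := (c.differentiableAt_toFun t ht).add_const w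
  continuousOn_deriv := by
    simpa only [deriv_add_const'] using c.continuousOn_deriv
  bounded_deriv := by
    simpa only [deriv_add_const'] using c.bounded_deriv
  T := c.T
  baseNW := c.baseNW + w
  dirNW := c.dirNW
  baseSE := c.baseSE + w
  dirSE := c.dirSE
  dirNW_mem := c.dirNW_mem
  dirSE_mem := c.dirSE_mem
  eq_NW t ht := by rw [c.eq_NW t ht]; ring
  eq_SE t ht := by rw [c.eq_SE t ht]; ring
  avoids t := hw _ (c.avoids t)

lemma integral_shift (c : NWSELine τ) (w : ℂ)
    (hw : ∀ z ∉ southwestClosed τ, z + w ∉ southwestClosed τ) (f : ℂ → ℂ) :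
    (c.shift w hw).integral f = c.integral fun ζ => f (ζ + w) := by
  simp only [integral, pullback, shift, deriv_add_const']

lemma integral_congr (c : NWSELine τ) {f g : ℂ → ℂ} (h : ∀ z ∉ southwestClosed τ, f z = g z) :
    c.integral f = c.integral g := by
  simp only [integral, pullback]
  congr 1 with t
  rw [h _ (c.avoids t)]

/-- The line suits `z`, and the quadratic part of the phase decays at its southeastern end. -/
def SuitsGauss (c : NWSELine τ) (z : ℂ) : Prop :=
  (c.dirNW * z / τ).im < 0 ∧ 0 < (c.dirSE ^ 2 / τ).im

lemma SuitsGauss.suits {c : NWSELine τ} {z : ℂ} (h : c.SuitsGauss z) : c.Suits z :=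
  ⟨h.1, .inl h.2⟩

end NWSELine

section

variable {τ : ℂ} (hτ : 0 < τ.im)

include hτ

/-- The purely quadratic condition at the southeastern end involves neither `z` nor the base point.
One line can therefore be translated, and kept for z + 1, z + τ and all nearby z. -/
lemma exists_suitsGauss {z : ℂ} (hz : z ∉ southwestClosed τ) :
    ∃ c : NWSELine τ, c.SuitsGauss z := by
  have h0 := ne_zero_of_im_pos hτ
  have hu1 := im_one_div_neg hτ
  have e1 (x y : ℝ) : ((x - y * τ) * z / τ).im = x * (z / τ).im - y * z.im := by
    rw [← im_ofReal_mul, ← im_ofReal_mul, ← sub_im]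
    congr 1
    field_simp
  have e2 (y : ℝ) : (((1 : ℝ) - y * τ) ^ 2 / τ).im = (1 / τ).im + y ^ 2 * τ.im := by
    have : (((1 : ℝ) - y * τ) ^ 2 / τ : ℂ) =
        1 / τ - ((2 * y : ℝ) : ℂ) + ((y ^ 2 : ℝ) : ℂ) * τ := by
      push_cast
      field_simp
      ring
    rw [this, add_im, sub_im, im_ofReal_mul, ofReal_im, sub_zero]
  obtain ⟨d₁, hd₁, hdz⟩ : ∃ d ∈ southeast τ, (d * z / τ).im < 0 := by
    rcases (notMem_southwestClosed_iff hτ).1 hz with h | h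
    · refine ⟨_, ⟨(|z.im| + 1) / -(z / τ).im, 1, div_pos (by positivity) (by linarith), one_pos,
        rfl⟩, ?_⟩
      rw [e1]
      have : (|z.im| + 1) / -(z / τ).im * -(z / τ).im = |z.im| + 1 :=
        div_mul_cancel₀ _ (by linarith)
      linarith [neg_abs_le z.im]
    · refine ⟨_, ⟨1, (|(z / τ).im| + 1) / z.im, one_pos, by positivity, rfl⟩, ?_⟩
      rw [e1, div_mul_cancel₀ _ h.ne']
      linarith [le_abs_self (z / τ).im]
  obtain ⟨d₂, hd₂, hd₂'⟩ : ∃ d ∈ southeast τ, 0 < (d ^ 2 / τ).im := by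
    -- With this choice y ≥ 1, so y² Im τ ≥ y Im τ = Im τ - Im(1/τ) > -Im(1/τ).
    set y := 1 + -(1 / τ).im / τ.im with hy
    have hy0 : 0 < -(1 / τ).im / τ.im := div_pos (by linarith) hτ
    refine ⟨_, ⟨1, y, one_pos, by positivity, rfl⟩, ?_⟩
    rw [e2]
    have : y * τ.im = τ.im + -(1 / τ).im := by rw [hy]; field_simp
    nlinarith
  exact ⟨.bent hτ hd₁ hd₂, hdz, hd₂'⟩

/-- For z = -x - yτ in S and d southeastern, Im(dz/τ) = -(x Im(d/τ) + y Im d) is nonnegative,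
against the northwestern condition. -/
lemma NWSELine.Suits.notMem {c : NWSELine τ} {z : ℂ} (hc : c.Suits z) :
    z ∉ southwestClosed τ := by
  rintro ⟨x, y, hx, hy, rfl⟩
  have h0 := ne_zero_of_im_pos hτ
  have h1 := hc.1
  have e : c.dirNW * (-x - y * τ) / τ = -((x : ℂ) * (c.dirNW / τ) + y * c.dirNW) := by
    field_simp
    ring
  rw [e, neg_im, add_im, im_ofReal_mul, im_ofReal_mul] at h1
  have := im_neg_of_mem_southeast hτ c.dirNW_mem
  have := im_div_neg_of_mem_southeast hτ c.dirNW_mem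
  nlinarith

lemma add_one_notMem {z : ℂ} (hz : z ∉ southwestClosed τ) : z + 1 ∉ southwestClosed τ := by
  rw [notMem_southwestClosed_iff hτ] at hz ⊢
  refine hz.imp (fun h => (im_add_one_div_lt hτ).trans h) fun h => by simpa using h

lemma add_tau_notMem {z : ℂ} (hz : z ∉ southwestClosed τ) : z + τ ∉ southwestClosed τ := by
  rw [notMem_southwestClosed_iff hτ] at hz ⊢
  refine hz.imp (fun h => by rwa [im_add_tau_div hτ]) fun h => by rw [add_im]; linarith

lemma NWSELine.SuitsGauss.add_one {c : NWSELine τ} {z : ℂ} (hc : c.SuitsGauss z) :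
    c.SuitsGauss (z + 1) := by
  refine ⟨?_, hc.2⟩
  rw [mul_add, add_div, add_im, mul_one]
  linarith [hc.1, im_div_neg_of_mem_southeast hτ c.dirNW_mem]

lemma NWSELine.SuitsGauss.add_tau {c : NWSELine τ} {z : ℂ} (hc : c.SuitsGauss z) :
    c.SuitsGauss (z + τ) := by
  refine ⟨?_, hc.2⟩
  rw [mul_add, add_div, add_im, mul_div_cancel_right₀ _ (ne_zero_of_im_pos hτ)]
  linarith [hc.1, im_neg_of_mem_southeast hτ c.dirNW_mem]

/-! ### The integral as a function of `z` -/

open Classical in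
omit hτ in
/-- The common value of the integrals along all lines that suit `z`. -/
def tauGammaIntegral (τ z : ℂ) : ℂ :=
  if h : ∃ c : NWSELine τ, c.Suits z then h.choose.integral (tauGammaIntegrand τ z) else 0

lemma tauGammaIntegral_eq {c : NWSELine τ} {z : ℂ} (hc : c.Suits z) :
    tauGammaIntegral τ z = c.integral (tauGammaIntegrand τ z) := by
  have h : ∃ c : NWSELine τ, c.Suits z := ⟨c, hc⟩
  rw [tauGammaIntegral, dif_pos h]
  exact NWSELine.integral_eq_of_suits hτ h.choose_spec hc

/-! ### Difference equations of the integral -/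

lemma tauGammaIntegrand_add_one (z : ℂ) {ζ : ℂ} (hζ : ζ ∉ southwestClosed τ) :
    tauGammaIntegrand τ z (ζ + 1) = exp (2 * Real.pi * I * z / τ) *
      (tauGammaIntegrand τ z ζ - tauGammaIntegrand τ (z + 1) ζ) := by
  have e1 : exp (2 * Real.pi * I * (ζ + 1) * z / τ) =
      exp (2 * Real.pi * I * z / τ) * exp (2 * Real.pi * I * ζ * z / τ) := by
    rw [← exp_add]; congr 1; ring
  have e2 : exp (2 * Real.pi * I * ζ * (z + 1) / τ) =
      exp (2 * Real.pi * I * ζ / τ) * exp (2 * Real.pi * I * ζ * z / τ) := by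
    rw [← exp_add]; congr 1; ring
  simp only [tauGammaIntegrand_eq]
  rw [recipGamma_add_one hτ hζ, e1, e2]
  ring

lemma tauGammaIntegrand_add_tau (z : ℂ) {ζ : ℂ} (hζ : ζ ∉ southwestClosed τ) :
    tauGammaIntegrand τ z (ζ + τ) = exp (2 * Real.pi * I * z) *
      (tauGammaIntegrand τ z ζ - tauGammaIntegrand τ (z + τ) ζ) := by
  have h0 := ne_zero_of_im_pos hτ
  have e1 : exp (2 * Real.pi * I * (ζ + τ) * z / τ) =
      exp (2 * Real.pi * I * z) * exp (2 * Real.pi * I * ζ * z / τ) := by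
    rw [← exp_add]; congr 1; field_simp; ring
  have e2 : exp (2 * Real.pi * I * ζ * (z + τ) / τ) =
      exp (2 * Real.pi * I * ζ) * exp (2 * Real.pi * I * ζ * z / τ) := by
    rw [← exp_add]; congr 1; field_simp; ring
  simp only [tauGammaIntegrand_eq]
  rw [recipGamma_add_tau hτ hζ, e1, e2]
  ring

omit hτ in
lemma NWSELine.integral_mul_sub (c : NWSELine τ) (a : ℂ) {f g : ℂ → ℂ}
    (hf : Integrable (c.pullback f)) (hg : Integrable (c.pullback g)) :
    c.integral (fun ζ => a * (f ζ - g ζ)) = a * (c.integral f - c.integral g) := by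
  rw [integral, integral, integral, ← integral_sub hf hg, ← integral_const_mul]
  congr 1 with t
  simp only [pullback]
  ring

/-- Translating the line by 1 leaves the integral unchanged, while the integrand splits: I(z) =
e^{2πiz/τ}(I(z) - I(z+1)). -/
lemma tauGammaIntegral_add_one {z : ℂ} (hz : z ∉ southwestClosed τ) :
    tauGammaIntegral τ (z + 1) =
      (1 - exp (-2 * Real.pi * I * z / τ)) * tauGammaIntegral τ z := by
  have e : exp (-2 * Real.pi * I * z / τ) * exp (2 * Real.pi * I * z / τ) = 1 := by
    rw [← exp_add, ← exp_zero]; congr 1; ring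
  obtain ⟨c, hc⟩ := exists_suitsGauss hτ hz
  have hs : (c.shift 1 fun _ => add_one_notMem hτ).Suits z := ⟨hc.1, .inl hc.2⟩
  have h1 := tauGammaIntegral_eq hτ hc.suits
  have h2 := tauGammaIntegral_eq hτ (hc.add_one hτ).suits
  have h3 := tauGammaIntegral_eq hτ hs
  rw [NWSELine.integral_shift, c.integral_congr fun ζ => tauGammaIntegrand_add_one hτ z,
    c.integral_mul_sub _ (hc.suits.integrable hτ) ((hc.add_one hτ).suits.integrable hτ),
    ← h1, ← h2] at h3
  linear_combination (exp (-2 * Real.pi * I * z / τ)) * h3 +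
    (tauGammaIntegral τ z - tauGammaIntegral τ (z + 1)) * e

lemma tauGammaIntegral_add_tau {z : ℂ} (hz : z ∉ southwestClosed τ) :
    tauGammaIntegral τ (z + τ) =
      (1 - exp (-2 * Real.pi * I * z)) * tauGammaIntegral τ z := by
  have e : exp (-2 * Real.pi * I * z) * exp (2 * Real.pi * I * z) = 1 := by
    rw [← exp_add, ← exp_zero]; congr 1; ring
  obtain ⟨c, hc⟩ := exists_suitsGauss hτ hz
  have hs : (c.shift τ fun _ => add_tau_notMem hτ).Suits z := ⟨hc.1, .inl hc.2⟩
  have h1 := tauGammaIntegral_eq hτ hc.suits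
  have h2 := tauGammaIntegral_eq hτ (hc.add_tau hτ).suits
  have h3 := tauGammaIntegral_eq hτ hs
  rw [NWSELine.integral_shift, c.integral_congr fun ζ => tauGammaIntegrand_add_tau hτ z,
    c.integral_mul_sub _ (hc.suits.integrable hτ) ((hc.add_tau hτ).suits.integrable hτ),
    ← h1, ← h2] at h3
  linear_combination (exp (-2 * Real.pi * I * z)) * h3 +
    (tauGammaIntegral τ z - tauGammaIntegral τ (z + τ)) * e

end

end

noncomputable section

/-! ### The value of the integral at `1` -/

section

variable {τ : ℂ} (hτ : 0 < τ.im)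

include hτ

omit hτ in
-- The shift by `s` changes the linear coefficient in t by at most 2|Im(d/τ)|, which the positive
-- quadratic term absorbs uniformly in `s`.
lemma exists_le_gaussPhase_add {z b d : ℂ} (h : 0 < (d ^ 2 / τ).im) :
    ∃ M : ℝ, ∀ᶠ t : ℝ in atTop, ∀ s : ℝ, 0 ≤ s → s ≤ 1 →
      t + M ≤ gaussPhase τ z (b + s + t * d) := by
  set A := (d ^ 2 / τ).im with hA
  set B := (d * (2 * b + 2 * z - 1 - τ) / τ).im with hB
  set U := (d / τ).im with hU
  set X := ((2 * b + 2 * z - 1 - τ) / τ).im with hX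
  set V := (1 / τ).im with hV
  have e (t s : ℝ) : gaussPhase τ z (b + s + t * d) =
      t * (B + (2 * s) * U + t * A) + (gaussPhase τ z b + s * X + s ^ 2 * V) := by
    rw [gaussPhase, gaussPhase, hA, hB, hU, hX, hV, ← im_ofReal_mul t (_ / τ), ← im_ofReal_mul s,
      ← im_ofReal_mul (2 * s), ← im_ofReal_mul (s ^ 2), ← add_im, ← add_im, ← add_im, ← add_im,
      ← im_ofReal_mul, ← add_im]
    congr 1
    push_cast
    ring
  refine ⟨gaussPhase τ z b - |X| - |V|, ?_⟩
  filter_upwards [(tendsto_const_add_mul (B - 2 * |U|) h).eventually_ge_atTop 1,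
    eventually_ge_atTop 0] with t ht ht0 s hs0 hs1
  rw [e]
  have h1 : -|U| ≤ s * U := by nlinarith [neg_abs_le U, abs_nonneg U]
  have h2 : -|X| ≤ s * X := by nlinarith [neg_abs_le X, abs_nonneg X]
  have h3 : -|V| ≤ s ^ 2 * V := by
    have : s ^ 2 ≤ 1 := pow_le_one₀ hs0 hs1
    nlinarith [neg_abs_le V, abs_nonneg V, sq_nonneg s]
  have h4 : 1 ≤ B + (2 * s) * U + t * A := by linarith
  nlinarith

lemma tendsto_sub_add_one_southeast {z b d : ℂ} (hd : d ∈ southeast τ)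
    (h : 0 < (d ^ 2 / τ).im) {P : ℂ → ℂ}
    (hP : ∀ ζ ∉ southwestClosed τ, HasDerivAt P (tauGammaIntegrand τ z ζ) ζ) :
    Tendsto (fun t : ℝ => P (b + t * d + 1) - P (b + t * d)) atTop (𝓝 0) := by
  obtain ⟨K, R, hK, hR, hb⟩ := exists_norm_integrand_le_southeast hτ
  obtain ⟨M, h⟩ := exists_le_gaussPhase_add (z := z) (b := b) h
  refine tendsto_sub_of_segment hP (ε := Real.pi) Real.pi_pos
    (M := K * Real.exp (-(Real.pi * M))) ?_ (a := 1) (d := 0) (fun t => by ring)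
  filter_upwards [eventually_southeast hτ hd b R, h] with t h1 h2 w hw
  rw [segment_eq_image'] at hw
  obtain ⟨s, ⟨hs0, hs1⟩, rfl⟩ := hw
  have e : b + t * d + s • (b + t * d + 1 - (b + t * d)) = b + t * d + s := by
    rw [real_smul]; ring
  dsimp only
  rw [e]
  have b1 : (b + t * d + s).im ≤ -R := by
    rw [add_im, ofReal_im]; linarith [h1.1]
  have b2 : ((b + t * d + s) / τ).im ≤ -R := by
    rw [add_div, add_im, show (s / τ : ℂ) = s * (1 / τ) by ring, im_ofReal_mul]
    nlinarith [h1.2, im_one_div_neg hτ]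
  have b3 := h2 s hs0 hs1
  rw [add_right_comm] at b3
  refine ⟨notMem_southwestClosed_of_southeast hτ hR b2, (hb z _ b1 b2).trans ?_⟩
  rw [mul_assoc, ← Real.exp_add]
  gcongr
  nlinarith [Real.pi_pos]

omit hτ in
lemma tauGammaIntegrand_zero (ζ : ℂ) : tauGammaIntegrand τ 0 ζ = recipGamma τ ζ := by
  simp [tauGammaIntegrand_eq]

lemma tendsto_sub_add_one_northwest {a d : ℂ} (hd : d ∈ southeast τ) {P : ℂ → ℂ}
    (hP : ∀ ζ ∉ southwestClosed τ, HasDerivAt P (tauGammaIntegrand τ 0 ζ) ζ) :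
    Tendsto (fun t : ℝ => P (a - t * d) - P (a - t * d + 1)) atTop (𝓝 (-1)) := by
  rw [Metric.tendsto_nhds]
  intro ε hε
  obtain ⟨R, hR, hb⟩ := exists_norm_recipGamma_sub_one_le hτ (half_pos hε)
  filter_upwards [eventually_northwest hτ hd a R, eventually_northwest hτ hd (a + 1) R]
    with t h1 h2
  have e : a + 1 - t * d = a - t * d + 1 := by ring
  rw [e] at h2
  -- The integrand at z = 0 is close to 1, so P(ζ) - ζ is almost constant across a unit step.
  have key := norm_sub_le_of_segment (p := a - t * d + 1) (q := a - t * d)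
    (P := fun ζ => P ζ - ζ) (f := fun ζ => tauGammaIntegrand τ 0 ζ - 1) (M := ε / 2)
    (fun w hw => (hP w (notMem_southwestClosed_of_northwest hτ hR
      (le_im_mul_of_mem_segment hw 1 h2.1 h1.1))).sub (hasDerivAt_id w))
    (fun w hw => by
      rw [tauGammaIntegrand_zero]
      exact hb w (by simpa using le_im_mul_of_mem_segment hw 1 h2.1 h1.1)
        (le_im_mul_of_mem_segment hw τ⁻¹ h2.2 h1.2))
  rw [show a - t * d - (a - t * d + 1) = -1 by ring, norm_neg, norm_one, mul_one] at key
  rw [dist_eq_norm]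
  calc _ = ‖P (a - t * d) - (a - t * d) - (P (a - t * d + 1) - (a - t * d + 1))‖ := by
        congr 1; ring
    _ ≤ ε / 2 := key
    _ < ε := by linarith

lemma one_notMem_southwestClosed : (1 : ℂ) ∉ southwestClosed τ :=
  (notMem_southwestClosed_iff hτ).2 (.inl (im_one_div_neg hτ))

/-- No line suits z = 0, but the integrand there still has a primitive P. The integrand at z = 1
then has primitive P(ζ) - P(ζ+1), which tends to 0 in the southeast and to -1 in the northwest. -/
lemma tauGammaIntegral_one : tauGammaIntegral τ 1 = 1 := by
  obtain ⟨c, hc⟩ := exists_suitsGauss hτ (one_notMem_southwestClosed hτ)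
  obtain ⟨P, hP⟩ := exists_primitive hτ fun _ => differentiableAt_tauGammaIntegrand hτ 0
  have hQ (ζ : ℂ) (hζ : ζ ∉ southwestClosed τ) :
      HasDerivAt (fun ζ => P ζ - P (ζ + 1)) (tauGammaIntegrand τ 1 ζ) ζ := by
    have h1 := (hP ζ hζ).sub ((hP _ (add_one_notMem hτ hζ)).comp_add_const ζ 1)
    have h2 := tauGammaIntegrand_add_one hτ 0 hζ
    rw [mul_zero, zero_div, exp_zero, one_mul, zero_add] at h2
    refine h1.congr_deriv ?_
    rw [h2]
    ring
  obtain ⟨A, B, hA, hB, e⟩ := c.exists_tendsto_primitive (hc.suits.integrable hτ) hQ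
  have h1 : A = -0 := by
    refine tendsto_nhds_unique (hA.congr' ?_)
      (tendsto_sub_add_one_southeast hτ (b := c.baseSE) c.dirSE_mem hc.2 hP).neg
    filter_upwards [c.eventually_toFun_eq] with t ht
    rw [ht]
    ring
  have h2 : B = -1 := by
    refine tendsto_nhds_unique (hB.congr' ?_)
      (tendsto_sub_add_one_northwest hτ (a := c.baseNW) c.dirNW_mem hP)
    filter_upwards [c.eventually_toFun_neg_eq] with t ht
    rw [ht]
  rw [tauGammaIntegral_eq hτ hc.suits, e, h1, h2]
  ring

/-! ### Holomorphy of the integral -/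

omit hτ in
-- The norm grows at most linearly along the ends, so a small η costs only half of the decay rate.
-- This leaves room for a dominating function when z varies.
lemma NWSELine.Decays.exp_norm_mul {c : NWSELine τ} {f : ℂ → ℂ} (h : c.Decays f) :
    ∃ η : ℝ, 0 < η ∧ c.Decays fun ζ => (Real.exp (η * ‖ζ‖) : ℂ) * f ζ := by
  obtain ⟨M, ε, hM, hε, h1, h2⟩ := h
  set b := ‖c.baseNW‖ + ‖c.baseSE‖
  set d := ‖c.dirNW‖ + ‖c.dirSE‖
  have hd : 0 ≤ d := by positivity
  set η := ε / (2 * (d + 1)) with hη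
  have hη0 : 0 < η := by positivity
  have hηd : η * d ≤ ε / 2 := by
    have : η * (d + 1) = ε / 2 := by rw [hη]; field_simp
    linarith
  have key {w : ℂ} {t : ℝ} (ht : 0 ≤ t) (hw : ‖w‖ ≤ b + t * d)
      (hf : ‖f w‖ ≤ M * Real.exp (-(ε * t))) : ‖(Real.exp (η * ‖w‖) : ℂ) * f w‖ ≤
      (M * Real.exp (η * b)) * Real.exp (-(ε / 2 * t)) := by
    rw [norm_mul, norm_real, Real.norm_of_nonneg (Real.exp_nonneg _)]
    calc _ ≤ Real.exp (η * (b + t * d)) * (M * Real.exp (-(ε * t))) := by gcongr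
      _ = M * Real.exp (η * (b + t * d) + -(ε * t)) := by rw [Real.exp_add]; ring
      _ ≤ M * Real.exp (η * b + -(ε / 2 * t)) := by
        have := mul_le_mul_of_nonneg_right hηd ht
        gcongr M * Real.exp ?_
        linarith
      _ = _ := by rw [Real.exp_add]; ring
  refine ⟨η, hη0, M * Real.exp (η * b), ε / 2, by positivity, by positivity, ?_, ?_⟩
  · filter_upwards [h1, c.eventually_toFun_eq, eventually_ge_atTop 0] with t h1 h2 ht
    refine key ht ?_ h1
    rw [h2]
    refine (norm_add_le _ _).trans ?_
    rw [norm_mul, norm_real, Real.norm_of_nonneg ht]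
    gcongr
    · exact le_add_of_nonneg_left (norm_nonneg _)
    · exact le_add_of_nonneg_left (norm_nonneg _)
  · filter_upwards [h2, c.eventually_toFun_neg_eq, eventually_ge_atTop 0] with t h1 h2 ht
    refine key ht ?_ h1
    rw [h2]
    refine (norm_sub_le _ _).trans ?_
    rw [norm_mul, norm_real, Real.norm_of_nonneg ht]
    gcongr
    · exact le_add_of_nonneg_right (norm_nonneg _)
    · exact le_add_of_nonneg_right (norm_nonneg _)

omit hτ in
lemma hasDerivAt_tauGammaIntegrand_param (z ζ : ℂ) :
    HasDerivAt (fun z => tauGammaIntegrand τ z ζ)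
      (2 * Real.pi * I / τ * ζ * tauGammaIntegrand τ z ζ) z := by
  simp_rw [tauGammaIntegrand_eq]
  have h2 : HasDerivAt (fun z : ℂ => 2 * Real.pi * I * ζ * z / τ)
      (2 * Real.pi * I * ζ * 1 / τ) z := ((hasDerivAt_id z).const_mul _).div_const τ
  refine (h2.cexp.mul_const _).congr_deriv ?_
  ring

omit hτ in
-- One factor e^{Lδ‖ζ‖} pays for moving from z₀ to z, and another absorbs the factor ζ through x ≤
-- e^x; hence the 2 in the exponent.
lemma norm_param_deriv_le {z z₀ ζ : ℂ} {L δ : ℝ} (hL : L = ‖2 * Real.pi * I / τ‖) (hδ : 0 < δ)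
    (hz : ‖z - z₀‖ ≤ δ) : ‖2 * Real.pi * I / τ * ζ * tauGammaIntegrand τ z ζ‖ ≤
      δ⁻¹ * ‖(Real.exp (2 * L * δ * ‖ζ‖) : ℂ) * tauGammaIntegrand τ z₀ ζ‖ := by
  have hL0 : 0 ≤ L := hL ▸ norm_nonneg _
  have e : tauGammaIntegrand τ z ζ =
      exp (2 * Real.pi * I / τ * ζ * (z - z₀)) * tauGammaIntegrand τ z₀ ζ := by
    simp only [tauGammaIntegrand_eq]
    rw [← mul_assoc, ← exp_add]
    congr 2
    ring
  have h1 : ‖exp (2 * Real.pi * I / τ * ζ * (z - z₀))‖ ≤ Real.exp (L * δ * ‖ζ‖) := by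
    rw [norm_exp, Real.exp_le_exp]
    refine (re_le_norm _).trans ?_
    rw [norm_mul, norm_mul, ← hL]
    calc L * ‖ζ‖ * ‖z - z₀‖ ≤ L * ‖ζ‖ * δ := by gcongr
      _ = _ := by ring
  have h2 : L * ‖ζ‖ ≤ δ⁻¹ * Real.exp (L * δ * ‖ζ‖) := by
    rw [← div_eq_inv_mul, le_div_iff₀ hδ]
    linarith [Real.add_one_le_exp (L * δ * ‖ζ‖)]
  rw [e, norm_mul, norm_mul, norm_mul, norm_mul, ← hL, norm_real,
    Real.norm_of_nonneg (Real.exp_nonneg _)]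
  calc _ ≤ δ⁻¹ * Real.exp (L * δ * ‖ζ‖) *
        (Real.exp (L * δ * ‖ζ‖) * ‖tauGammaIntegrand τ z₀ ζ‖) := by gcongr
    _ = δ⁻¹ * ((Real.exp (L * δ * ‖ζ‖) * Real.exp (L * δ * ‖ζ‖)) *
        ‖tauGammaIntegrand τ z₀ ζ‖) := by ring
    _ = _ := by
      rw [← Real.exp_add]
      ring_nf

lemma NWSELine.Suits.differentiableAt_integral {c : NWSELine τ} {z₀ : ℂ} (hc : c.Suits z₀) :
    DifferentiableAt ℂ (fun z => c.integral (tauGammaIntegrand τ z)) z₀ := by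
  have h0 := ne_zero_of_im_pos hτ
  have hdiff (z : ℂ) := fun (ζ : ℂ) (hζ : ζ ∉ southwestClosed τ) =>
    differentiableAt_tauGammaIntegrand hτ z hζ
  obtain ⟨η, hη, hdec⟩ := (hc.decays hτ).exp_norm_mul
  set L := ‖2 * Real.pi * I / τ‖ with hL
  have hL0 : 0 < L := norm_pos_iff.2 (div_ne_zero two_pi_I_ne_zero h0)
  set δ := η / (2 * L) with hδ
  have hδ0 : 0 < δ := by positivity
  have hLδ : 2 * L * δ = η := by rw [hδ]; field_simp
  have hcont : Continuous fun t => (Real.exp (η * ‖c.toFun t‖) : ℂ) *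
      tauGammaIntegrand τ z₀ (c.toFun t) := by
    refine Continuous.mul ?_ (c.continuous_comp (hdiff z₀))
    have := c.continuous_toFun
    fun_prop
  have hg : Integrable fun t => deriv c.toFun t * ((Real.exp (η * ‖c.toFun t‖) : ℂ) *
      tauGammaIntegrand τ z₀ (c.toFun t)) := by
    obtain ⟨M, ε, -, hε, h1, h2⟩ := hdec
    exact c.integrable_deriv_mul (integrable_of_exp_decay hcont hε h1 h2)
  have hm {k : ℝ → ℂ} (hk : Continuous k) :
      AEStronglyMeasurable (fun t => deriv c.toFun t * k t) volume :=
    (stronglyMeasurable_deriv _).aestronglyMeasurable.mul hk.aestronglyMeasurable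
  have key := hasDerivAt_integral_of_dominated_loc_of_deriv_le
    (F := fun z t => c.pullback (tauGammaIntegrand τ z) t)
    (F' := fun z t => deriv c.toFun t *
      (2 * Real.pi * I / τ * c.toFun t * tauGammaIntegrand τ z (c.toFun t)))
    (bound := fun t => δ⁻¹ * ‖deriv c.toFun t * ((Real.exp (η * ‖c.toFun t‖) : ℂ) *
      tauGammaIntegrand τ z₀ (c.toFun t))‖)
    (μ := volume) (x₀ := z₀) (Metric.ball_mem_nhds z₀ hδ0)
    (.of_forall fun z => hm (c.continuous_comp (hdiff z))) (hc.integrable hτ)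
    (hm ((continuous_const.mul c.continuous_toFun).mul (c.continuous_comp (hdiff z₀))))
    (.of_forall fun t z hz => by
      rw [norm_mul, norm_mul (deriv _ _), mul_left_comm]
      gcongr
      rw [← hLδ]
      exact norm_param_deriv_le hL hδ0 (mem_ball_iff_norm.1 hz).le)
    (hg.norm.const_mul _)
    (.of_forall fun t z hz => (hasDerivAt_tauGammaIntegrand_param z _).const_mul _)
  exact key.2.differentiableAt

lemma differentiableAt_tauGammaIntegral {z : ℂ} (hz : z ∉ southwestClosed τ) :
    DifferentiableAt ℂ (tauGammaIntegral τ) z := by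
  obtain ⟨c, hc⟩ := exists_suitsGauss hτ hz
  refine (hc.suits.differentiableAt_integral hτ).congr_of_eventuallyEq ?_
  have ho : IsOpen {w : ℂ | (c.dirNW * w / τ).im < 0} := isOpen_lt (by fun_prop) continuous_const
  filter_upwards [ho.mem_nhds hc.1] with w hw
  exact tauGammaIntegral_eq hτ (c := c) ⟨hw, .inl hc.2⟩

/-! ### Comparison with the `γ`-function -/

omit hτ in
/-- A function on an open set which is invariant under a translation that sweeps out the plane
extends to an entire function. -/
lemma exists_entire_extension {U : Set ℂ} (hU : IsOpen U) {w : ℂ} (hw : ∀ z ∈ U, z + w ∈ U)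
    (hex : ∀ z, ∃ n : ℕ, z + n * w ∈ U) {f : ℂ → ℂ} (hf : ∀ z ∈ U, DifferentiableAt ℂ f z)
    (hfw : ∀ z ∈ U, f (z + w) = f z) :
    ∃ g : ℂ → ℂ, Differentiable ℂ g ∧ ∀ (z : ℂ) (n : ℕ), z + n * w ∈ U → g z = f (z + n * w) := by
  have hstep (z : ℂ) (n k : ℕ) (hz : z + n * w ∈ U) :
      z + (n + k : ℕ) * w ∈ U ∧ f (z + (n + k : ℕ) * w) = f (z + n * w) := by
    induction k with
    | zero => exact ⟨hz, rfl⟩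
    | succ k ih =>
      have e : z + (n + (k + 1) : ℕ) * w = z + (n + k : ℕ) * w + w := by push_cast; ring
      rw [e]
      exact ⟨hw _ ih.1, (hfw _ ih.1).trans ih.2⟩
  -- The choice of `N` is arbitrary; invariance makes the value independent of it, so near any point
  -- one fixed translate can be used.
  choose N hN using hex
  have hg (z : ℂ) (n : ℕ) (hz : z + n * w ∈ U) : f (z + N z * w) = f (z + n * w) := by
    rw [← (hstep z (N z) n (hN z)).2, ← (hstep z n (N z) hz).2, add_comm n]
  refine ⟨fun z => f (z + N z * w), fun z => ?_, hg⟩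
  have h1 : DifferentiableAt ℂ (fun x => f (x + N z * w)) z :=
    (hf _ (hN z)).fun_comp' z (differentiableAt_id.add_const _)
  refine h1.congr_of_eventuallyEq ?_
  have hc : ContinuousAt (fun x : ℂ => x + N z * w) z := by fun_prop
  filter_upwards [hc.preimage_mem_nhds (hU.mem_nhds (hN z))] with x hx using hg x _ hx

lemma isPreconnected_compl_southwestClosed : IsPreconnected (southwestClosed τ)ᶜ := by
  have e : (southwestClosed τ)ᶜ = {z | (z / τ).im < 0} ∪ {z | 0 < z.im} :=
    Set.ext fun z => notMem_southwestClosed_iff hτ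
  rw [e]
  refine (convex_im_div τ).isPreconnected.union (1 + τ) ?_ ?_ convex_im_pos.isPreconnected
  · change ((1 + τ) / τ).im < 0
    rw [im_add_tau_div hτ]
    exact im_one_div_neg hτ
  · simpa using hτ

/-- On this region I is defined and N has no zeros, so I·D/N is holomorphic and invariant under the
shifts by 1 and -τ. The region is stable only in these directions, but 1 - τ eventually moves every
point into it, which yields an entire doubly periodic extension. -/
lemma tauGammaIntegral_mul_eq {z : ℂ} (hz : (z / τ).im < 0) (hz' : z.im < τ.im) :
    tauGammaIntegral τ z * gammaDen τ z / gammaNum τ z = gammaDen τ 1 / gammaNum τ 1 := by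
  have h0 := ne_zero_of_im_pos hτ
  have hu1 := im_one_div_neg hτ
  have hD := differentiable_gammaDen hτ
  have hN := differentiable_gammaNum hτ
  set U : Set ℂ := {z | (z / τ).im < 0 ∧ z.im < τ.im}
  have hUo : IsOpen U := isOpen_im_div_neg.inter (isOpen_lt continuous_im continuous_const)
  have hUS {z : ℂ} (hz : z ∈ U) : z ∉ southwestClosed τ :=
    (notMem_southwestClosed_iff hτ).2 (.inl hz.1)
  set f : ℂ → ℂ := fun z => tauGammaIntegral τ z * gammaDen τ z / gammaNum τ z with hf
  have hU1 (z : ℂ) (hz : z ∈ U) : z + 1 ∈ U :=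
    ⟨(im_add_one_div_lt hτ).trans hz.1, by simpa using hz.2⟩
  have hUτ (z : ℂ) (hz : z ∈ U) : z - τ ∈ U := by
    refine ⟨?_, ?_⟩
    · rw [sub_div, div_self h0]; simpa using hz.1
    · have := hz.2
      simp only [sub_im]
      linarith
  have hf1 (z : ℂ) (hz : z ∈ U) : f (z + 1) = f z := by
    simp only [hf]
    rw [tauGammaIntegral_add_one hτ (hUS hz), gammaDen_eq_mul_add_one hτ z, gammaNum_add_one]
    ring
  have hfτ (z : ℂ) (hz : z ∈ U) : f (z - τ) = f z := by
    have e1 := tauGammaIntegral_add_tau hτ (hUS (hUτ z hz))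
    have e2 := gammaNum_add_tau hτ (z - τ)
    have e3 := gammaDen_add_tau hτ (z - τ)
    rw [sub_add_cancel] at e1 e2 e3
    have h1 := gammaNum_ne_zero hτ hz.2
    rw [e2] at h1
    simp only [hf]
    rw [e1, e2, e3, mul_assoc, mul_div_mul_left _ _ (left_ne_zero_of_mul h1)]
  have hfd (z : ℂ) (hz : z ∈ U) : DifferentiableAt ℂ f z :=
    ((differentiableAt_tauGammaIntegral hτ (hUS hz)).mul (hD z)).div (hN z)
      (gammaNum_ne_zero hτ hz.2)
  have hmem (z : ℂ) (n : ℕ) : z + n * (1 - τ) ∈ U ↔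
      (z / τ).im + n * (1 / τ).im < 0 ∧ z.im - n * τ.im < τ.im := by
    have e1 : (z + n * (1 - τ)) / τ = z / τ + ((n : ℝ) : ℂ) * (1 / τ) - ((n : ℝ) : ℂ) := by
      push_cast; field_simp; ring
    have e2 : z + n * (1 - τ) = z + ((n : ℝ) : ℂ) - ((n : ℝ) : ℂ) * τ := by push_cast; ring
    change ((z + n * (1 - τ)) / τ).im < 0 ∧ (z + n * (1 - τ)).im < τ.im ↔ _
    rw [e1, e2, sub_im, add_im, im_ofReal_mul, ofReal_im, sub_zero,
      sub_im, add_im, im_ofReal_mul, ofReal_im, add_zero]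
  have hlarge (z : ℂ) : ∃ n : ℕ, z + n * (1 - τ) ∈ U := by
    simp_rw [hmem]
    obtain ⟨n, hn⟩ := exists_nat_gt (max ((z / τ).im / -(1 / τ).im) (z.im / τ.im))
    refine ⟨n, ?_, ?_⟩
    · have := (div_lt_iff₀ (neg_pos.2 hu1)).1 ((le_max_left _ _).trans_lt hn)
      linarith
    · have := (div_lt_iff₀ hτ).1 ((le_max_right _ _).trans_lt hn)
      linarith
  obtain ⟨g, hg, hgf⟩ := exists_entire_extension hUo (w := 1 - τ)
    (fun z hz => by
      have := hUτ _ (hU1 z hz)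
      rwa [add_sub_assoc] at this)
    hlarge
    hfd
    (fun z hz => by
      rw [← add_sub_assoc, hfτ _ (hU1 z hz), hf1 z hz])
  have hg1 (z : ℂ) : g (z + 1) = g z := by
    obtain ⟨n, hn⟩ := hlarge z
    have e : z + 1 + n * (1 - τ) = z + n * (1 - τ) + 1 := by ring
    have h1 := hU1 _ hn
    rw [hgf z n hn, hgf (z + 1) n (by rwa [e]), e, hf1 _ hn]
  have hgτ (z : ℂ) : g (z + τ) = g z := by
    obtain ⟨n, hn⟩ := hlarge (z + τ)
    have e : z + n * (1 - τ) = z + τ + n * (1 - τ) - τ := by ring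
    have h1 := hUτ _ hn
    rw [hgf (z + τ) n hn, hgf z n (by rwa [e]), e, hfτ _ hn]
  have hgU {z : ℂ} (hz : z ∈ U) : g z = f z := by
    have := hgf z 0 (by simpa using hz)
    simpa using this
  have h1U : (1 : ℂ) ∈ U := ⟨hu1, by simpa using hτ⟩
  have := eq_of_differentiable_of_periodic hτ hg hg1 hgτ z 1
  rw [hgU ⟨hz, hz'⟩, hgU h1U] at this
  simpa only [hf, tauGammaIntegral_one hτ, one_mul] using this

/-- The comparison holds near 1, and both sides are analytic on the connected complement of S. -/
lemma tauGamma_eq_mul_tauGammaIntegral {z : ℂ} (hz : z ∉ southwestClosed τ) :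
    tauGamma τ z = tauGamma τ 1 * tauGammaIntegral τ z := by
  have hu1 := im_one_div_neg hτ
  have hS := isOpen_compl_southwestClosed hτ
  have han : AnalyticOnNhd ℂ (tauGamma τ) (southwestClosed τ)ᶜ :=
    DifferentiableOn.analyticOnNhd (fun z hz =>
      (differentiableAt_tauGamma hτ hz).differentiableWithinAt) hS
  have han' : AnalyticOnNhd ℂ (fun z => tauGamma τ 1 * tauGammaIntegral τ z)
      (southwestClosed τ)ᶜ :=
    DifferentiableOn.analyticOnNhd (fun z hz =>
      ((differentiableAt_tauGammaIntegral hτ hz).const_mul _).differentiableWithinAt) hS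
  refine han.eqOn_of_preconnected_of_eventuallyEq han'
    (isPreconnected_compl_southwestClosed hτ) (one_notMem_southwestClosed hτ) ?_ hz
  have h1 : {z : ℂ | z.im < τ.im} ∈ 𝓝 (1 : ℂ) :=
    (isOpen_lt continuous_im continuous_const).mem_nhds (by simpa using hτ)
  filter_upwards [isOpen_im_div_neg.mem_nhds hu1, h1] with w hw hw'
  have key := tauGammaIntegral_mul_eq hτ hw hw'
  have n1 := gammaDen_ne_zero hτ hw
  have n2 := gammaNum_ne_zero hτ hw'
  have n3 := gammaDen_ne_zero hτ hu1
  have n4 := gammaNum_ne_zero hτ (z := 1) (by simpa using hτ)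
  rw [tauGamma_eq_of_gammaDen_ne_zero hτ n1, tauGamma_eq_of_gammaDen_ne_zero hτ n3]
  rw [div_eq_div_iff n2 n4] at key
  field_simp
  linear_combination -key

end

end

theorem mainTheorem6 (τ : ℂ) (hτ : 0 < τ.im) :
    Tendsto (fun z : ℂ => 2 * Real.pi * I / τ * (z * tauGamma τ z)) (𝓝[≠] 0)
        (𝓝 (tauGamma τ 1)) ∧
      (∀ z : ℂ, z ∉ southwestClosed τ → ∃ c : NWSELine τ, c.Suits z) ∧
      ∀ (z : ℂ) (c : NWSELine τ), c.Suits z →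
        Integrable (c.pullback (tauGammaIntegrand τ z)) ∧
          tauGamma τ z = tauGamma τ 1 * c.integral (tauGammaIntegrand τ z) := by
  refine ⟨tendsto_mul_tauGamma hτ, fun z hz => ?_, fun z c hc => ⟨hc.integrable hτ, ?_⟩⟩
  · obtain ⟨c, hc⟩ := exists_suitsGauss hτ hz
    exact ⟨c, hc.suits⟩
  · rw [← tauGammaIntegral_eq hτ hc]
    exact tauGamma_eq_mul_tauGammaIntegral hτ (hc.notMem hτ)
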